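/- All Hilbert spaces are finite-dimensional. Let $|\psi\rangle^{RAB}$ be a pure state, let $\dim\mathcal H^{B'}=\dim\mathcal H^{A}$, and for systems $\mathcal H^{\overline A},\mathcal H^{\overline B}$ of dimension at least $K$ let $|\Phi_K^+\rangle^{\overline A\,\overline B}=K^{-1/2}\sum_{l<K}|l\rangle\otimes|l\rangle$. For $\varepsilon\ge 0$, a protocol for approximate state merging of $|\psi\rangle^{RAB}$ within $\varepsilon$, with integers $K,L\ge 1$, is an LOCC map $\mathcal M$ (a finite-round LOCC map, or more generally a limit as $r\to\infty$ of maps achieved by $r$-round LOCC protocols in which, up to final local operations conditioned on the outcomes so far, each protocol extends the preceding one by one more finite-outcome local measurement whose outcome is broadcast) between party $A$, holding $\mathcal H^{A}\otimes\mathcal H^{\overline A}$ and in the end $\mathcal H^{\overline A}$, and party $B$, holding $\mathcal H^{B}\otimes\mathcal H^{\overline B}$ and in the end $\mathcal H^{B'}\otimes\mathcal H^{B}\otimes\mathcal H^{\overline B}$, such that $\tilde\psi:=(\mathrm{id}^R\otimes\mathcal M)(\psi^{RAB}\otimes\Phi_K^{+\,\overline A\,\overline B})$ satisfies $$F^2\bigl(\tilde\psi,\psi^{RB'B}\otimes\Phi_L^{+\,\overline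 A\,\overline B}\bigr)=\bigl(\langle\psi|\otimes\langle\Phi_L^+|\bigr)\,\tilde\psi\,\bigl(|\psi\rangle\otimes|\Phi_L^+\rangle\bigr)\ \ge\ 1-\varepsilon^2 .$$ For a Hermitian operator $X$ let $\lambda(X)$ be the vector of its eigenvalues in descending order (padded with zeros), and let $\prec$ denote majorization. Let $C(\varepsilon)\in[-\infty,\infty]$ be the infimum of $\log_2K-\log_2L$ over all integers $K,L\ge1$ for which, for some $\mathcal H^{\overline A},\mathcal H^{\overline B}$ of dimension at least $\max(K,L)$, there is a finite ensemble $\{p(j),|\psi_j\rangle^{RB'B\overline A\,\overline B}\}_j$ of pure states such that $$\lambda\Bigl(\psi^{B}\otimes\tfrac{\mathbb 1_K^{\overline B}}{K}\Bigr)\prec\sum_jp(j)\,\lambda\bigl(\psi_j^{B'B\overline B}\bigr),\qquad F^2\Bigl(\sum_jp(j)|\psi_j\rangle\langle\psi_j|,\ \psi^{RB'B}\otimes\Phi_L^{+\,\overline A\,\overline B}\Bigr)\ge 1-\varepsilon^2 .$$ Then: 1. For every $\varepsilon\ge0$ and every protocol for approximate state merging of $|\psi\rangle^{RAB}$ within $\varepsilon$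 with parameters $K,L$, it holds that $\log_2K-\log_2L\ \ge\ C(\varepsilon)$. 2. The limits below exist (the left one in $[-\infty,\infty]$, the right one in $\mathbb R$), and $$\lim_{\varepsilon_1\to0^+}C(\varepsilon_1)\ \ge\ \lim_{\varepsilon_1,\varepsilon_2\to0^+}\bigl(H_{\min}^{\varepsilon_2}(AB)_\psi-H_{\min}^{\varepsilon_1+\varepsilon_2}(B)_\psi\bigr),$$ where $H_{\min}(\sigma)=\sup\{h\in\mathbb R:\sigma\le2^{-h}\mathbb 1\}$ and $H_{\min}^{\varepsilon}(\rho)=\sup H_{\min}(\sigma)$ over all $\sigma\ge0$ with $\operatorname{tr}\sigma\le1$ and $\sqrt{1-F_*^2(\rho,\sigma)}\le\varepsilon$, with $F_*(\rho,\sigma)=\|\sqrt\rho\sqrt\sigma\|_1+\sqrt{(1-\operatorname{tr}\rho)(1-\operatorname{tr}\sigma)}$. (The difference of smooth min-entropies on the right is the earlier converse bound for entanglement cost.) -/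

import Mathlib

open Filter Topology
open scoped Kronecker ComplexOrder

namespace StateMerging

noncomputable section

/-! ### States

A finite-dimensional system with a computational basis is a finite type of basis labels; composite
systems are products of types. A vector is a function on the labels, an operator is a matrix. -/

/-- Unit vectors, that is, pure states. -/
def IsPureState {n : Type*} [Fintype n] (v : n → ℂ) : Prop :=
  ∑ i, ‖v i‖ ^ 2 = 1

/-- The operator `|v⟩⟨v|`. -/
def proj {n : Type*} (v : n → ℂ) : Matrix n n ℂ :=
  Matrix.vecMulVec v (star v)

/-- Partial trace over the first tensor factor. -/
def traceFst {m n : Type*} [Fintype m] (ρ : Matrix (m × n) (m × n) ℂ) : Matrix n n ℂ :=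
  Matrix.of fun j j' => ∑ i, ρ (i, j) (i, j')

/-- The squared fidelity `F²(ρ, |t⟩⟨t|) = ⟨t|ρ|t⟩` of a state with a pure state. -/
def fidelitySqPure {n : Type*} [Fintype n] (ρ : Matrix n n ℂ) (t : n → ℂ) : ℝ :=
  (star t ⬝ᵥ (ρ.mulVec t)).re

/-- The maximally entangled state `Φ_K⁺ = K^{-1/2} ∑_{l<K} |l⟩ ⊗ |l⟩` of Schmidt rank `K` in
`ℂ^N ⊗ ℂ^M`. -/
def maxEnt (K N M : ℕ) : Fin N × Fin M → ℂ := fun x =>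
  if x.1.val = x.2.val ∧ x.1.val < K then (((Real.sqrt K)⁻¹ : ℝ) : ℂ) else 0

/-- The operator `𝟙_K / K` on `ℂ^M`, where `𝟙_K` projects onto the first `K` basis vectors. -/
def maxMixed (K M : ℕ) : Matrix (Fin M) (Fin M) ℂ :=
  Matrix.diagonal fun l => if l.val < K then (((K : ℝ)⁻¹ : ℝ) : ℂ) else 0

/-! ### Spectra and majorization -/

open Classical in
/-- The eigenvalues of a Hermitian matrix with multiplicity, in descending order, followed by
zeros. -/
def spec {n : Type*} [Fintype n] [DecidableEq n] (X : Matrix n n ℂ) : ℕ → ℝ := fun k =>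
  if h : X.IsHermitian ∧ k < Fintype.card n then h.1.eigenvalues₀ ⟨k, h.2⟩ else 0

/-- Majorization `x ≺ y` of real vectors with `D` elements, both in descending order. -/
def Majorized (D : ℕ) (x y : ℕ → ℝ) : Prop :=
  (∀ m ≤ D, ∑ l ∈ Finset.range m, x l ≤ ∑ l ∈ Finset.range m, y l) ∧
    ∑ l ∈ Finset.range D, x l = ∑ l ∈ Finset.range D, y l

/-! ### Local operations and classical communication between two parties -/

/-- A finite family of measurement operators (possibly between different systems) satisfying the
completeness condition. -/
def IsMeasurement {ι m n : Type*} [Fintype ι] [Fintype m] [DecidableEq n]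
    (M : ι → Matrix m n ℂ) : Prop :=
  ∑ i, (M i).conjTranspose * M i = 1

/-- Tuples of the outcomes of the first `r` measurements, the `i`-th of which has `n i`
outcomes. -/
def Hist (n : ℕ → ℕ) : ℕ → Type
  | 0 => Unit
  | r + 1 => Hist n r × Fin (n r)

instance instFintypeHist (n : ℕ → ℕ) : (r : ℕ) → Fintype (Hist n r)
  | 0 => inferInstanceAs (Fintype Unit)
  | r + 1 =>
    letI := instFintypeHist n r
    inferInstanceAs (Fintype (Hist n r × Fin (n r)))

/-- A sequence of `r`-round LOCC protocols, `r = 1, 2, …`, between two parties with input systems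
`a`, `b` and output systems `a'`, `b'`, in which the non-correcting part of each protocol is
LOCC linked to the non-correcting part of the preceding one.

The parties first embed their systems isometrically into local workspaces (auxiliary systems are
allowed). In each round one of the parties measures, conditioned on all the preceding outcomes, and
broadcasts the outcome. In the `r`-round protocol, the first `r` rounds are followed by a local
measurement of each party conditioned on the outcomes of these rounds, into the output systems. -/
structure LOCCSequence (a b a' b' : Type*) [Fintype a] [Fintype b] [Fintype a'] [Fintype b']
    [DecidableEq a] [DecidableEq b] where
  /-- Dimension of the first party's workspace. -/
  x : ℕ
  /-- Dimension of the second party's workspace. -/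
  y : ℕ
  VA : Matrix (Fin x) a ℂ
  VB : Matrix (Fin y) b ℂ
  isometryA : VA.conjTranspose * VA = 1
  isometryB : VB.conjTranspose * VB = 1
  /-- Numbers of outcomes of the successive rounds. -/
  n : ℕ → ℕ
  MA : (r : ℕ) → Hist n r → Fin (n r) → Matrix (Fin x) (Fin x) ℂ
  MB : (r : ℕ) → Hist n r → Fin (n r) → Matrix (Fin y) (Fin y) ℂ
  /-- In each round, one party measures and the other one does nothing. -/
  oneWay : ∀ r, (∀ h, IsMeasurement (MA r h) ∧ ∀ m, MB r h m = 1) ∨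
    (∀ h, IsMeasurement (MB r h) ∧ ∀ m, MA r h m = 1)
  /-- Numbers of outcomes of the final local measurements. -/
  nA : ℕ → ℕ
  nB : ℕ → ℕ
  FA : (r : ℕ) → Hist n r → Fin (nA r) → Matrix a' (Fin x) ℂ
  FB : (r : ℕ) → Hist n r → Fin (nB r) → Matrix b' (Fin y) ℂ
  finalA : ∀ r h, IsMeasurement (FA r h)
  finalB : ∀ r h, IsMeasurement (FB r h)

namespace LOCCSequence

variable {a b a' b' : Type*} [Fintype a] [Fintype b] [Fintype a'] [Fintype b']
  [DecidableEq a] [DecidableEq b]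

/-- The first party's part of the measurement operator for the given outcomes. -/
def opA (P : LOCCSequence a b a' b') : (r : ℕ) → Hist P.n r → Matrix (Fin P.x) a ℂ
  | 0, _ => P.VA
  | r + 1, h => P.MA r h.1 h.2 * P.opA r h.1

/-- The second party's part of the measurement operator for the given outcomes. -/
def opB (P : LOCCSequence a b a' b') : (r : ℕ) → Hist P.n r → Matrix (Fin P.y) b ℂ
  | 0, _ => P.VB
  | r + 1, h => P.MB r h.1 h.2 * P.opB r h.1

/-- The measurement operators of the `r`-round protocol. -/
def op (P : LOCCSequence a b a' b') (r : ℕ) (h : Hist P.n r) (i : Fin (P.nA r))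
    (j : Fin (P.nB r)) : Matrix (a' × b') (a × b) ℂ :=
  (P.FA r h i * P.opA r h) ⊗ₖ (P.FB r h j * P.opB r h)

/-- The map achieved by the `r`-round protocol. -/
def roundMap (P : LOCCSequence a b a' b') (r : ℕ) (ρ : Matrix (a × b) (a × b) ℂ) :
    Matrix (a' × b') (a' × b') ℂ :=
  ∑ h, ∑ i, ∑ j, P.op r h i j * ρ * (P.op r h i j).conjTranspose

end LOCCSequence

/-- LOCC maps: the limits of the maps achieved by LOCC-linked sequences of `r`-round LOCC as
`r → ∞` (finite-round LOCC maps are the eventually constant case). -/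
def IsLOCC {a b a' b' : Type*} [Fintype a] [Fintype b] [Fintype a'] [Fintype b']
    [DecidableEq a] [DecidableEq b]
    (E : Matrix (a × b) (a × b) ℂ →ₗ[ℂ] Matrix (a' × b') (a' × b') ℂ) : Prop :=
  ∃ P : LOCCSequence a b a' b', ∀ ρ, Tendsto (fun r => P.roundMap r ρ) atTop (𝓝 (E ρ))

/-- The map `id^R ⊗ E`. -/
def idTensor (R : Type*) {m n : Type*} (E : Matrix m m ℂ →ₗ[ℂ] Matrix n n ℂ)
    (ρ : Matrix (R × m) (R × m) ℂ) : Matrix (R × n) (R × n) ℂ :=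
  Matrix.of fun u v => E (Matrix.of fun s t => ρ (u.1, s) (v.1, t)) u.2 v.2

/-! ### Approximate state merging

`A'`s systems are `A` and `Ā = ℂ^N`; `B'`s systems are `B`, `B' = A` and `B̄ = ℂ^M`. -/

section Merging

variable {R A B : Type*}

/-- The initial vector `|ψ⟩^{RAB} ⊗ |Φ_K⁺⟩^{ĀB̄}`, on `R ⊗ ((A ⊗ Ā) ⊗ (B ⊗ B̄))`. -/
def initialVec (ψ : R × A × B → ℂ) (K N M : ℕ) :
    R × ((A × Fin N) × (B × Fin M)) → ℂ := fun w =>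
  ψ (w.1, w.2.1.1, w.2.2.1) * maxEnt K N M (w.2.1.2, w.2.2.2)

/-- The target vector `|ψ⟩^{RB'B} ⊗ |Φ_L⁺⟩^{ĀB̄}`, on `R ⊗ (Ā ⊗ (B' ⊗ B ⊗ B̄))`. -/
def targetVec (ψ : R × A × B → ℂ) (L N M : ℕ) :
    R × (Fin N × (A × B × Fin M)) → ℂ := fun w =>
  ψ (w.1, w.2.2.1, w.2.2.2.1) * maxEnt L N M (w.2.1, w.2.2.2.2)

variable [Fintype R] [Fintype A] [Fintype B] [DecidableEq A] [DecidableEq B]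

/-- The reduced state `ψ^{AB}`. -/
def reducedAB (ψ : R × A × B → ℂ) : Matrix (A × B) (A × B) ℂ :=
  traceFst (proj ψ)

/-- The reduced state `ψ^B`. -/
def reducedB (ψ : R × A × B → ℂ) : Matrix B B ℂ :=
  traceFst (reducedAB ψ)

/-- `E` is an LOCC map achieving approximate state merging of `ψ` within `ε`, with initial resource
`Φ_K⁺` and final resource `Φ_L⁺` in `Ā ⊗ B̄ = ℂ^N ⊗ ℂ^M`. -/
structure IsApproxMerging (ψ : R × A × B → ℂ) (ε : ℝ) (K L N M : ℕ)
    (E : Matrix ((A × Fin N) × (B × Fin M)) ((A × Fin N) × (B × Fin M)) ℂ →ₗ[ℂ]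
      Matrix (Fin N × (A × B × Fin M)) (Fin N × (A × B × Fin M)) ℂ) : Prop where
  K_pos : 1 ≤ K
  L_pos : 1 ≤ L
  K_le : K ≤ N ∧ K ≤ M
  L_le : L ≤ N ∧ L ≤ M
  locc : IsLOCC E
  fidelity : 1 - ε ^ 2 ≤
    fidelitySqPure (idTensor R E (proj (initialVec ψ K N M))) (targetVec ψ L N M)

/-- The conditions of the converse bound on `K`, `L` (for some finite-dimensional `Ā`, `B̄` holding
`Φ_K⁺` and `Φ_L⁺`): there is an ensemble `{p(j), |ψ_j⟩^{RB'BĀB̄}}` of pure states with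
`λ(ψ^B ⊗ 𝟙_K/K) ≺ ∑ⱼ p(j) λ(ψ_j^{B'BB̄})` and
`F²(∑ⱼ p(j)|ψ_j⟩⟨ψ_j|, ψ^{RB'B} ⊗ Φ_L⁺) ≥ 1 - ε²`. -/
def Feasible (ψ : R × A × B → ℂ) (ε : ℝ) (K L : ℕ) : Prop :=
  1 ≤ K ∧ 1 ≤ L ∧ ∃ N M : ℕ, (K ≤ N ∧ K ≤ M) ∧ (L ≤ N ∧ L ≤ M) ∧
    ∃ (J : ℕ) (p : Fin J → ℝ) (Ψ : Fin J → R × (Fin N × (A × B × Fin M)) → ℂ),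
      (∀ j, 0 ≤ p j) ∧ ∑ j, p j = 1 ∧ (∀ j, IsPureState (Ψ j)) ∧
      Majorized (Fintype.card (A × B × Fin M))
        (spec (reducedB ψ ⊗ₖ maxMixed K M))
        (fun l => ∑ j, p j * spec (traceFst (traceFst (proj (Ψ j)))) l) ∧
      1 - ε ^ 2 ≤ fidelitySqPure (∑ j, (p j : ℂ) • proj (Ψ j)) (targetVec ψ L N M)

/-- The infimum of `log₂ K - log₂ L` over all `K`, `L` satisfying the conditions of the converse
bound, in the extended reals. -/
def converseBound (ψ : R × A × B → ℂ) (ε : ℝ) : EReal :=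
  sInf {c : EReal | ∃ K L : ℕ, Feasible ψ ε K L ∧
    c = ((Real.logb 2 K - Real.logb 2 L : ℝ) : EReal)}

end Merging

/-! ### Smooth min-entropy -/

section MinEntropy

variable {n : Type*} [Fintype n] [DecidableEq n]

/-- The trace norm `‖X‖₁ = tr √(X†X)`. -/
def traceNorm (X : Matrix n n ℂ) : ℝ :=
  (cfc Real.sqrt (X.conjTranspose * X)).trace.re

/-- The generalized fidelity `‖√ρ√σ‖₁ + √((1 - tr ρ)(1 - tr σ))` of sub-normalized operators. -/
def genFidelity (ρ σ : Matrix n n ℂ) : ℝ :=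
  traceNorm (cfc Real.sqrt ρ * cfc Real.sqrt σ) +
    Real.sqrt ((1 - ρ.trace.re) * (1 - σ.trace.re))

/-- The purified distance of sub-normalized operators. -/
def purifiedDist (ρ σ : Matrix n n ℂ) : ℝ :=
  Real.sqrt (1 - genFidelity ρ σ ^ 2)

/-- The min-entropy `sup {h ∈ ℝ : ρ ≤ 2^{-h} 𝟙}`, in the extended reals. -/
def minEntropy (ρ : Matrix n n ℂ) : EReal :=
  sSup {c : EReal | ∃ h : ℝ, c = (h : EReal) ∧
    ((((2 : ℝ) ^ (-h) : ℝ) : ℂ) • (1 : Matrix n n ℂ) - ρ).PosSemidef}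

/-- The `ε`-smooth min-entropy: the supremum of the min-entropy over the sub-normalized operators
within purified distance `ε`. -/
def smoothMinEntropy (ε : ℝ) (ρ : Matrix n n ℂ) : EReal :=
  sSup {c : EReal | ∃ σ : Matrix n n ℂ, σ.PosSemidef ∧ σ.trace.re ≤ 1 ∧
    purifiedDist ρ σ ≤ ε ∧ c = minEntropy σ}

end MinEntropy

end

end StateMerging

/-! Everything is phrased through Ky Fan sums, the sums of the `m` largest eigenvalues, which equal
the maximum of `tr(PX)` over `0 ≤ P ≤ 1` with `tr P ≤ m`. This variational form makes them
subadditive, and 2-Lipschitz in the norm of a purifying unit vector.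

Claim 1. Write a pure state as a matrix `Y` from `RA` to `B`, so that `B`'s reduced state is `YY†`.
A measurement on `A`'s side decomposes `YY†` into the reduced states of the branches. A measurement
on `B`'s side decomposes `Y†Y`, which has the same nonzero spectrum. By subadditivity, the Ky Fan
sums of `B`'s state never decrease on average (`LOCCSequence.splits`). This is the required
majorization for a finite-round protocol. In the limit `r → ∞` the number of branches may grow, but
only finitely many numbers matter: the Ky Fan sums and the overlap with the target. These lie in the
convex hull of a compact set, which is compact by Carathéodory's theorem, so a limit point is again
realized by a finite ensemble (`IsApproxMerging.feasible`).

Claim 2. Let `b` and `a` be the largest eigenvalues of `ψ^B` and `ψ^{AB}`. The `K`-th majorization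
inequality and the continuity of Ky Fan sums give `b ≤ (K/L) a + 3ε`
(`Feasible.kyFan_one_reducedB_le`), hence `C(ε) ≥ log₂(b - 3ε) - log₂ a`. The right side tends to
`log₂ b - log₂ a`. So does the entropy difference, because a smooth min-entropy of a normalized
state tends to minus the logarithm of its largest eigenvalue: testing with an optimal `P` shows that
smoothing by `ε` lowers this eigenvalue by at most `ε`. -/

namespace StateMerging

noncomputable section

open Matrix

/-! ### Ky Fan sums and their variational principle -/

section KyFan

variable {n : Type*} [Fintype n] [DecidableEq n]

/-- The Ky Fan sum of the `m` largest eigenvalues. -/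
def kyFan (m : ℕ) (X : Matrix n n ℂ) : ℝ := ∑ l ∈ Finset.range m, spec X l

/-- Positivity is what keeps the order descending across the padding by zeros. -/
theorem spec_antitone_nonneg {X : Matrix n n ℂ} (hX : X.PosSemidef) :
    Antitone (spec X) ∧ ∀ k, 0 ≤ spec X k := by
  have h0 : ∀ k, 0 ≤ spec X k := by
    intro k
    unfold spec
    split_ifs with h
    · have := hX.eigenvalues_nonneg ((Fintype.equivOfCardEq (Fintype.card_fin _)) ⟨k, h.2⟩)
      simpa [IsHermitian.eigenvalues] using this
    · exact le_rfl
  refine ⟨fun k l hkl => ?_, h0⟩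
  by_cases hl : l < Fintype.card n
  · have hk : k < Fintype.card n := lt_of_le_of_lt hkl hl
    simp only [spec, hX.1, hl, hk, and_self, dif_pos]
    exact hX.1.eigenvalues₀_antitone hkl
  · have : spec X l = 0 := by simp [spec, hl]
    rw [this]; exact h0 k

/-- The position of an eigenvalue in the descending order. -/
def eigIndex (i : n) : ℕ :=
  ((Fintype.equivOfCardEq (Fintype.card_fin _)).symm i : Fin (Fintype.card n))

theorem spec_eigIndex {X : Matrix n n ℂ} (hX : X.IsHermitian) (i : n) :
    spec X (eigIndex i) = hX.eigenvalues i := by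
  have : eigIndex i < Fintype.card n := Fin.is_lt _
  simp only [spec, hX, this, and_self, dif_pos, IsHermitian.eigenvalues]
  rfl

omit [DecidableEq n] in
theorem sum_eigIndex (f : ℕ → ℝ) :
    ∑ i : n, f (eigIndex i) = ∑ k ∈ Finset.range (Fintype.card n), f k := by
  rw [Finset.sum_range]
  exact Equiv.sum_comp (Fintype.equivOfCardEq (Fintype.card_fin _)).symm (fun k => f (k : ℕ))

omit [DecidableEq n] in
theorem sum_range_eq_sum_eigIndex (m : ℕ) (f : ℕ → ℝ) (hf : ∀ k, Fintype.card n ≤ k → f k = 0) :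
    ∑ k ∈ Finset.range m, f k = ∑ i : n, if eigIndex i < m then f (eigIndex i) else 0 := by
  rw [sum_eigIndex (n := n) (fun k => if k < m then f k else 0), ← Finset.sum_filter]
  symm
  apply Finset.sum_subset_zero_on_sdiff
  · intro k; simp
  · intro k hk
    simp only [Finset.mem_sdiff, Finset.mem_range, Finset.mem_filter, not_and] at hk
    exact hf k (by by_contra h; exact hk.2 (by omega) hk.1)
  · intros; rfl

theorem spec_eq_zero_of_card_le (X : Matrix n n ℂ) {k : ℕ} (hk : Fintype.card n ≤ k) :
    spec X k = 0 := by
  simp [spec, Nat.not_lt.mpr hk]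

theorem kyFan_eq_sum {X : Matrix n n ℂ} (hX : X.IsHermitian) (m : ℕ) :
    kyFan m X = ∑ i : n, if eigIndex i < m then hX.eigenvalues i else 0 := by
  rw [kyFan, sum_range_eq_sum_eigIndex m _ (fun k hk => spec_eq_zero_of_card_le X hk)]
  simp [spec_eigIndex hX]

theorem kyFan_eq_trace {X : Matrix n n ℂ} (hX : X.IsHermitian) {m : ℕ} (hm : Fintype.card n ≤ m) :
    kyFan m X = X.trace.re := by
  rw [kyFan_eq_sum hX, hX.trace_eq_sum_eigenvalues, Complex.re_sum]
  refine Finset.sum_congr rfl fun i _ => ?_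
  have : eigIndex i < m := lt_of_lt_of_le (Fin.is_lt _) hm
  simp [this]

theorem spectral_mul_cfc_sqrt {X : Matrix n n ℂ} (hX : X.IsHermitian) :
    ∃ U : Matrix n n ℂ, Uᴴ * U = 1 ∧ U * Uᴴ = 1 ∧
      X = U * diagonal (fun i => (hX.eigenvalues i : ℂ)) * Uᴴ ∧
      cfc Real.sqrt X = U * diagonal (fun i => ((Real.sqrt (hX.eigenvalues i) : ℝ) : ℂ)) * Uᴴ := by
  refine ⟨hX.eigenvectorUnitary, Unitary.coe_star_mul_self hX.eigenvectorUnitary,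
    Unitary.coe_mul_star_self hX.eigenvectorUnitary, ?_, ?_⟩
  · conv_lhs => rw [hX.spectral_theorem]
    rfl
  · rw [hX.cfc_eq]
    rfl

theorem spectral_mul {X : Matrix n n ℂ} (hX : X.IsHermitian) :
    ∃ U : Matrix n n ℂ, Uᴴ * U = 1 ∧ U * Uᴴ = 1 ∧
      X = U * diagonal (fun i => (hX.eigenvalues i : ℂ)) * Uᴴ := by
  obtain ⟨U, hU, hU', h, -⟩ := spectral_mul_cfc_sqrt hX
  exact ⟨U, hU, hU', h⟩

theorem trace_mul_diagonal_re (Q : Matrix n n ℂ) (d : n → ℝ) :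
    (Q * diagonal (fun i => (d i : ℂ))).trace.re = ∑ i, (Q i i).re * d i := by
  simp [Matrix.trace, Complex.re_sum, mul_diagonal]

omit [DecidableEq n] in
-- Bathtub principle: after subtracting the threshold `s m`, the first `m` terms are nonnegative and
-- the others nonpositive, so the best weights are 1 on the former and 0 on the latter.
theorem sum_mul_le_of_weights {d q : n → ℝ} {s : ℕ → ℝ} (hs : Antitone s) (hs0 : ∀ k, 0 ≤ s k)
    (hsz : ∀ k, Fintype.card n ≤ k → s k = 0)
    (hd : ∀ i, s (eigIndex i) = d i) (hq0 : ∀ i, 0 ≤ q i) (hq1 : ∀ i, q i ≤ 1) (m : ℕ)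
    (hqm : ∑ i, q i ≤ m) :
    ∑ i, q i * d i ≤ ∑ i, if eigIndex i < m then d i else 0 := by
  have h1 : ∑ i, q i * (d i - s m) ≤ ∑ i, if eigIndex i < m then d i - s m else 0 := by
    refine Finset.sum_le_sum fun i _ => ?_
    rw [← hd i]
    split_ifs with h
    · have := hs h.le
      nlinarith [hq1 i]
    · have := hs (not_lt.mp h)
      nlinarith [hq0 i]
  have h2 : ∑ i, q i * (d i - s m) = ∑ i, q i * d i - (∑ i, q i) * s m := by
    simp [mul_sub, Finset.sum_mul]
  have h3 : (∑ i : n, if eigIndex i < m then d i - s m else 0) =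
      (∑ i, if eigIndex i < m then d i else 0) - m * s m := by
    -- If `m` reaches the dimension, fewer than `m` indices may be available, but then the threshold
    -- `s m` is zero.
    by_cases hm : Fintype.card n ≤ m
    · simp [hsz m hm]
    · have h4 : ∑ k ∈ Finset.range m, (1 : ℝ) =
          ∑ i : n, if eigIndex i < m then (1 : ℝ) else 0 := by
        rw [sum_eigIndex (n := n) (fun k => if k < m then (1 : ℝ) else 0), ← Finset.sum_filter]
        refine Finset.sum_congr ?_ fun _ _ => rfl
        ext k; simp; omega
      have h5 : (m : ℝ) = ∑ i : n, if eigIndex i < m then (1 : ℝ) else 0 := by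
        rw [← h4]; simp
      rw [h5, Finset.sum_mul, ← Finset.sum_sub_distrib]
      refine Finset.sum_congr rfl fun i _ => ?_
      split_ifs <;> simp
  have := mul_le_mul_of_nonneg_right hqm (hs0 m)
  linarith

/-- In an eigenbasis of `X` the diagonal entries of `P` are weights in `[0, 1]` of total at most
`m`. -/
theorem trace_mul_le_kyFan {X P : Matrix n n ℂ} (hX : X.PosSemidef) (hP : P.PosSemidef)
    (hP1 : (1 - P).PosSemidef) {m : ℕ} (hm : P.trace.re ≤ m) :
    (P * X).trace.re ≤ kyFan m X := by
  obtain ⟨U, hU, hU', hXU⟩ := spectral_mul hX.1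
  have hQ := hP.conjTranspose_mul_mul_same U
  have hQ1 := hP1.conjTranspose_mul_mul_same U
  have e1 : (P * X).trace =
      (Uᴴ * P * U * diagonal (fun i => (hX.1.eigenvalues i : ℂ))).trace := by
    conv_lhs => rw [hXU]
    rw [← Matrix.mul_assoc, Matrix.trace_mul_comm]
    simp only [Matrix.mul_assoc]
  have e2 : (Uᴴ * P * U).trace = P.trace := by
    rw [Matrix.trace_mul_comm, ← Matrix.mul_assoc, hU', Matrix.one_mul]
  rw [e1, trace_mul_diagonal_re, kyFan_eq_sum hX.1]
  refine sum_mul_le_of_weights (s := spec X) (spec_antitone_nonneg hX).1 (spec_antitone_nonneg hX).2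
    (fun k hk => spec_eq_zero_of_card_le X hk) (fun i => spec_eigIndex hX.1 i) ?_ ?_ m ?_
  · intro i; exact (Complex.le_def.mp hQ.diag_nonneg).1
  · intro i
    have h := (Complex.le_def.mp (hQ1.diag_nonneg (i := i))).1
    rw [Matrix.mul_sub, Matrix.sub_mul, Matrix.mul_one, hU] at h
    simpa using h
  · rw [← e2] at hm
    simpa [Matrix.trace, Complex.re_sum] using hm

/-- The diagonal projection on the first `m` positions. -/
def cutDiag (n : Type*) [Fintype n] [DecidableEq n] (m : ℕ) : Matrix n n ℂ :=
  diagonal fun i => if eigIndex i < m then 1 else 0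

theorem trace_cutDiag_le (m : ℕ) : (cutDiag n m).trace.re ≤ m := by
  have : (cutDiag n m).trace.re = ∑ i : n, if eigIndex i < m then (1 : ℝ) else 0 := by
    simp only [cutDiag, trace_diagonal, Complex.re_sum]
    exact Finset.sum_congr rfl fun i _ => by split_ifs <;> simp
  rw [this, sum_eigIndex (n := n) (fun k => if k < m then (1 : ℝ) else 0), ← Finset.sum_filter]
  simp only [Finset.sum_const, nsmul_eq_mul, mul_one]
  have : (Finset.filter (fun k => k < m) (Finset.range (Fintype.card n))).card ≤
      (Finset.range m).card := Finset.card_le_card fun k => by simp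
  simpa using this

theorem posSemidef_of_isHermitian_of_mul_self {P : Matrix n n ℂ} (h : Pᴴ = P) (h2 : P * P = P) :
    P.PosSemidef ∧ (1 - P).PosSemidef := by
  constructor
  · have := posSemidef_conjTranspose_mul_self P
    rwa [h, h2] at this
  · have := posSemidef_conjTranspose_mul_self (1 - P)
    have e : (1 - P)ᴴ * (1 - P) = 1 - P := by
      rw [conjTranspose_sub, conjTranspose_one, h]
      simp [Matrix.mul_sub, Matrix.sub_mul, h2]
    rwa [e] at this

/-- The maximizer is the projection onto the eigenvectors of the `m` largest eigenvalues. Its trace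
is only bounded by `m`, since `m` may exceed the dimension. -/
theorem exists_trace_mul_eq_kyFan {X : Matrix n n ℂ} (hX : X.IsHermitian) (m : ℕ) :
    ∃ P : Matrix n n ℂ, P.PosSemidef ∧ (1 - P).PosSemidef ∧ P.trace.re ≤ m ∧
      (P * X).trace.re = kyFan m X := by
  obtain ⟨U, hU, hU', hXU⟩ := spectral_mul hX
  have hc : cutDiag n m * cutDiag n m = cutDiag n m := by
    simp only [cutDiag, diagonal_mul_diagonal]
    congr 1; ext i; split_ifs <;> simp
  have hcH : (cutDiag n m)ᴴ = cutDiag n m := by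
    simp only [cutDiag, diagonal_conjTranspose]
    congr 1; ext i; simp only [Pi.star_apply]; split_ifs <;> simp
  have hP := posSemidef_of_isHermitian_of_mul_self (P := U * cutDiag n m * Uᴴ)
    (by simp [conjTranspose_mul, hcH, Matrix.mul_assoc]) (by
      calc U * cutDiag n m * Uᴴ * (U * cutDiag n m * Uᴴ)
          = U * (cutDiag n m * (Uᴴ * U) * cutDiag n m) * Uᴴ := by simp only [Matrix.mul_assoc]
        _ = _ := by rw [hU, Matrix.mul_one, hc])
  refine ⟨U * cutDiag n m * Uᴴ, hP.1, hP.2, ?_, ?_⟩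
  · rw [Matrix.trace_mul_comm, ← Matrix.mul_assoc, hU, Matrix.one_mul]
    exact trace_cutDiag_le m
  · have : (U * cutDiag n m * Uᴴ * X).trace =
        (cutDiag n m * diagonal (fun i => (hX.eigenvalues i : ℂ))).trace := by
      conv_lhs => rw [hXU]
      calc _ = (U * (cutDiag n m * (Uᴴ * U) * diagonal (fun i => (hX.eigenvalues i : ℂ)) * Uᴴ)).trace := by
            simp only [Matrix.mul_assoc]
        _ = _ := by rw [Matrix.trace_mul_comm, hU, Matrix.mul_one, Matrix.mul_assoc, hU, Matrix.mul_one]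
    rw [this, trace_mul_diagonal_re, kyFan_eq_sum hX]
    refine Finset.sum_congr rfl fun i _ => ?_
    simp only [cutDiag, diagonal_apply_eq]
    split_ifs <;> simp

/-- A test operator optimal for the sum is admissible for every summand. -/
theorem kyFan_sum_le {ι : Type*} [Fintype ι] {X : ι → Matrix n n ℂ} (hX : ∀ j, (X j).PosSemidef)
    (m : ℕ) : kyFan m (∑ j, X j) ≤ ∑ j, kyFan m (X j) := by
  obtain ⟨P, hP, hP1, hPm, h⟩ := exists_trace_mul_eq_kyFan
    (posSemidef_sum Finset.univ fun j _ => hX j).1 m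
  rw [← h, Finset.mul_sum, trace_sum, Complex.re_sum]
  exact Finset.sum_le_sum fun j _ => trace_mul_le_kyFan (hX j) hP hP1 hPm

theorem kyFan_smul_le {X : Matrix n n ℂ} (hX : X.PosSemidef) {c : ℝ} (hc : 0 ≤ c) (m : ℕ) :
    kyFan m ((c : ℂ) • X) ≤ c * kyFan m X := by
  have hcX : ((c : ℂ) • X).PosSemidef := hX.smul (by exact_mod_cast hc)
  obtain ⟨P, hP, hP1, hPm, h⟩ := exists_trace_mul_eq_kyFan hcX.1 m
  rw [← h, Matrix.mul_smul, trace_smul, smul_eq_mul, Complex.re_ofReal_mul]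
  exact mul_le_mul_of_nonneg_left (trace_mul_le_kyFan hX hP hP1 hPm) hc

/-- The normalized images under `X` of the top `m` right singular vectors span a space of dimension
at most `m`. Testing `XX†` with the projection `WW†` onto it recovers the top eigenvalues of `X†X`.
-/
theorem kyFan_conjTranspose_mul_self_le {k : Type*} [Fintype k] [DecidableEq k]
    (X : Matrix k n ℂ) (m : ℕ) : kyFan m (Xᴴ * X) ≤ kyFan m (X * Xᴴ) := by
  have hX := posSemidef_conjTranspose_mul_self X
  have hX' := posSemidef_self_mul_conjTranspose X
  obtain ⟨U, hU, hU', hXU⟩ := spectral_mul hX.1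
  set d := hX.1.eigenvalues with hd
  have hd0 : ∀ i, 0 ≤ d i := hX.eigenvalues_nonneg
  set D : Matrix n n ℂ := diagonal (fun i => (d i : ℂ)) with hD
  have hD' : Uᴴ * (Xᴴ * X) * U = D := by
    rw [hXU]
    calc _ = (Uᴴ * U) * D * (Uᴴ * U) := by simp only [Matrix.mul_assoc]
      _ = D := by rw [hU]; simp
  -- The convention `0⁻¹ = 0` removes the kernel of `X`, so `W` is a partial isometry.
  set t : n → ℝ := fun i => if eigIndex i < m then (Real.sqrt (d i))⁻¹ else 0 with ht
  set T : Matrix n n ℂ := diagonal (fun i => (t i : ℂ)) with hT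
  have hTH : Tᴴ = T := by
    rw [hT, diagonal_conjTranspose]; congr 1; ext i; simp
  have htd : ∀ i, t i * d i * t i * t i = t i := by
    intro i
    simp only [ht]
    split_ifs with h
    · by_cases h0 : d i = 0
      · simp [h0]
      · have : Real.sqrt (d i) ≠ 0 := by
          rw [Real.sqrt_ne_zero']; exact lt_of_le_of_ne (hd0 i) (Ne.symm h0)
        have h2 := Real.mul_self_sqrt (hd0 i)
        field_simp
        rw [sq]; exact h2.symm
    · simp
  have htdd : ∀ i, t i * d i * d i * t i = if eigIndex i < m then d i else 0 := by
    intro i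
    simp only [ht]
    split_ifs with h
    · by_cases h0 : d i = 0
      · simp [h0]
      · have : Real.sqrt (d i) ≠ 0 := by
          rw [Real.sqrt_ne_zero']; exact lt_of_le_of_ne (hd0 i) (Ne.symm h0)
        have h2 := Real.mul_self_sqrt (hd0 i)
        field_simp
        rw [sq, h2]
    · simp
  set W := X * U * T with hW
  have hWW : Wᴴ * W = T * D * T := by
    rw [hW, conjTranspose_mul, conjTranspose_mul, hTH, ← hD']; simp only [Matrix.mul_assoc]
  have hWE : W * (Wᴴ * W) = W := by
    rw [hWW, hW]
    calc X * U * T * (T * D * T) = X * U * (T * (T * D * T)) := by simp only [Matrix.mul_assoc]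
      _ = X * U * T := by
        congr 1
        simp only [hT, hD, diagonal_mul_diagonal]
        congr 1; ext i
        exact_mod_cast (by linarith [htd i] : t i * (t i * d i * t i) = t i)
  have hP := posSemidef_of_isHermitian_of_mul_self (P := W * Wᴴ) (by simp) (by
    rw [← Matrix.mul_assoc, Matrix.mul_assoc W, hWE])
  have htr : (W * Wᴴ).trace.re ≤ m := by
    rw [Matrix.trace_mul_comm, hWW]
    refine le_trans ?_ (trace_cutDiag_le (n := n) m)
    simp only [hT, hD, diagonal_mul_diagonal, cutDiag, trace_diagonal, Complex.re_sum]
    refine Finset.sum_le_sum fun i _ => ?_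
    have e : ((t i : ℂ) * d i * t i).re = t i * d i * t i := by
      rw [← Complex.ofReal_mul, ← Complex.ofReal_mul, Complex.ofReal_re]
    rw [e]
    simp only [ht]
    split_ifs with h
    · by_cases h0 : d i = 0
      · simp [h0]
      · have : Real.sqrt (d i) ≠ 0 := by
          rw [Real.sqrt_ne_zero']; exact lt_of_le_of_ne (hd0 i) (Ne.symm h0)
        have h2 := Real.mul_self_sqrt (hd0 i)
        apply le_of_eq
        simp only [Complex.one_re]
        field_simp
        rw [sq, h2]
    · simp
  have key := trace_mul_le_kyFan hX' hP.1 hP.2 htr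
  have e : (W * Wᴴ * (X * Xᴴ)).trace = (T * D * D * T).trace := by
    calc (W * Wᴴ * (X * Xᴴ)).trace = (W * (Wᴴ * (X * Xᴴ))).trace := by rw [Matrix.mul_assoc]
      _ = (Wᴴ * (X * Xᴴ) * W).trace := Matrix.trace_mul_comm _ _
      _ = (T * (Uᴴ * (Xᴴ * X) * (U * Uᴴ) * (Xᴴ * X) * U) * T).trace := by
          rw [hU', hW, conjTranspose_mul, conjTranspose_mul, hTH, Matrix.mul_one]
          simp only [Matrix.mul_assoc]
      _ = (T * (Uᴴ * (Xᴴ * X) * U * (Uᴴ * (Xᴴ * X) * U)) * T).trace := by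
          simp only [Matrix.mul_assoc]
      _ = _ := by rw [hD']; simp only [Matrix.mul_assoc]
  rw [e] at key
  refine le_trans (le_of_eq ?_) key
  rw [kyFan_eq_sum hX.1]
  simp only [hT, hD, diagonal_mul_diagonal, trace_diagonal, Complex.re_sum]
  refine Finset.sum_congr rfl fun i _ => ?_
  have e : ((t i : ℂ) * d i * d i * t i).re = t i * d i * d i * t i := by
    rw [← Complex.ofReal_mul, ← Complex.ofReal_mul, ← Complex.ofReal_mul, Complex.ofReal_re]
  rw [e, htdd i]

theorem kyFan_conjTranspose_mul_self {k : Type*} [Fintype k] [DecidableEq k]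
    (X : Matrix k n ℂ) (m : ℕ) : kyFan m (Xᴴ * X) = kyFan m (X * Xᴴ) :=
  le_antisymm (kyFan_conjTranspose_mul_self_le X m)
    (by simpa using kyFan_conjTranspose_mul_self_le Xᴴ m)

end KyFan

/-! ### Monotonicity of averaged Ky Fan sums under local measurements -/

section Splitting

variable {b b' b'' k k' k'' ι κ : Type*} [Fintype b] [DecidableEq b] [Fintype b'] [DecidableEq b']
  [Fintype b''] [DecidableEq b''] [Fintype k] [Fintype k'] [Fintype k''] [Fintype ι] [Fintype κ]

/-- The Ky Fan sums of the reduced state of the (unnormalized) bipartite vector `Y` do not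
exceed the sums of those of the vectors `Z j`, and the `Z j` have the total weight of `Y`. -/
def Splits (Y : Matrix b k ℂ) (Z : ι → Matrix b' k' ℂ) : Prop :=
  (∀ m, kyFan m (Y * Yᴴ) ≤ ∑ j, kyFan m (Z j * (Z j)ᴴ)) ∧
    ∑ j, (Z j * (Z j)ᴴ).trace = (Y * Yᴴ).trace

theorem Splits.trans {Y : Matrix b k ℂ} {Z : ι → Matrix b' k' ℂ} {W : ι → κ → Matrix b'' k'' ℂ}
    (h : Splits Y Z) (h' : ∀ j, Splits (Z j) (W j)) :
    Splits Y (fun p : ι × κ => W p.1 p.2) := by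
  refine ⟨fun m => ?_, ?_⟩
  · rw [Fintype.sum_prod_type]
    exact (h.1 m).trans (Finset.sum_le_sum fun j _ => (h' j).1 m)
  · rw [Fintype.sum_prod_type, ← h.2]
    exact Finset.sum_congr rfl fun j _ => (h' j).2

/-- The complementary Gram matrix `Y†Y` is the sum of those of the branches and has the same Ky Fan
sums as `YY†`; subadditivity applies there. -/
theorem splits_measure_left (Y : Matrix b k ℂ) {M : ι → Matrix b' b ℂ} (hM : IsMeasurement M) :
    Splits Y (fun j => M j * Y) := by
  classical
  have h : ∑ j, (M j * Y)ᴴ * (M j * Y) = Yᴴ * Y := by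
    calc _ = ∑ j, Yᴴ * ((M j)ᴴ * M j) * Y :=
          Finset.sum_congr rfl fun j _ => by rw [conjTranspose_mul]; simp only [Matrix.mul_assoc]
      _ = Yᴴ * (∑ j, (M j)ᴴ * M j) * Y := by rw [Matrix.mul_sum, Matrix.sum_mul]
      _ = _ := by rw [hM, Matrix.mul_one]
  refine ⟨fun m => ?_, ?_⟩
  · simp only [← kyFan_conjTranspose_mul_self]
    rw [← h]
    exact kyFan_sum_le (fun j => posSemidef_conjTranspose_mul_self _) m
  · rw [Matrix.trace_mul_comm Y, ← h, trace_sum]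
    exact Finset.sum_congr rfl fun j _ => Matrix.trace_mul_comm _ _

/-- No signalling: the other side's measurement leaves `YY†` equal to the sum over the branches. -/
theorem splits_mul_right [DecidableEq k] (Y : Matrix b k ℂ) {C : ι → Matrix k k' ℂ}
    (hC : ∑ j, C j * (C j)ᴴ = 1) : Splits Y (fun j => Y * C j) := by
  have h : ∑ j, (Y * C j) * (Y * C j)ᴴ = Y * Yᴴ := by
    calc _ = ∑ j, Y * (C j * (C j)ᴴ) * Yᴴ :=
          Finset.sum_congr rfl fun j _ => by rw [conjTranspose_mul]; simp only [Matrix.mul_assoc]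
      _ = Y * (∑ j, C j * (C j)ᴴ) * Yᴴ := by rw [Matrix.mul_sum, Matrix.sum_mul]
      _ = _ := by rw [hC, Matrix.mul_one]
  refine ⟨fun m => ?_, ?_⟩
  · rw [← h]
    exact kyFan_sum_le (fun j => posSemidef_self_mul_conjTranspose _) m
  · rw [← h, trace_sum]

end Splitting

/-! ### Ky Fan sums along LOCC protocols -/

section Locc

variable {R : Type*} [Fintype R] [DecidableEq R]

/-- The operator `1^R ⊗ A` acting on the column index of a bipartite vector. -/
def colAct (R : Type*) [DecidableEq R] {a a' : Type*} (A : Matrix a' a ℂ) :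
    Matrix (R × a) (R × a') ℂ :=
  ((1 : Matrix R R ℂ) ⊗ₖ A)ᵀ

theorem colAct_mul {a a' a'' : Type*} [Fintype a'] (A : Matrix a'' a' ℂ) (A' : Matrix a' a ℂ) :
    colAct R (A * A') = colAct R A' * colAct R A := by
  rw [colAct, colAct, colAct, ← transpose_mul, ← mul_kronecker_mul, Matrix.one_mul]

omit [Fintype R] in
theorem colAct_one {a : Type*} [DecidableEq a] : colAct R (1 : Matrix a a ℂ) = 1 := by
  simp [colAct]

theorem sum_colAct {ι a a' : Type*} [Fintype ι] [Fintype a'] [DecidableEq a]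
    {A : ι → Matrix a' a ℂ} (hA : IsMeasurement A) :
    ∑ j, colAct R (A j) * (colAct R (A j))ᴴ = 1 := by
  have h : ∀ j, colAct R (A j) * (colAct R (A j))ᴴ = ((1 : Matrix R R ℂ) ⊗ₖ ((A j)ᴴ * A j))ᵀ := by
    intro j
    have : ((1 : Matrix R R ℂ) ⊗ₖ ((A j)ᴴ * A j)) =
        ((1 : Matrix R R ℂ) ⊗ₖ A j)ᴴ * ((1 : Matrix R R ℂ) ⊗ₖ A j) := by
      rw [conjTranspose_kronecker, ← mul_kronecker_mul]; simp
    rw [this, transpose_mul]; rfl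
  simp only [h]
  rw [← transpose_sum]
  have : ∑ j, (1 : Matrix R R ℂ) ⊗ₖ ((A j)ᴴ * A j) =
      (1 : Matrix R R ℂ) ⊗ₖ (∑ j, (A j)ᴴ * A j) := by
    ext u v
    simp [Matrix.sum_apply, kroneckerMap_apply, Finset.mul_sum]
  rw [this, hA]; simp

variable {a b a' b' : Type*} [Fintype a] [Fintype b] [Fintype a'] [Fintype b']
  [DecidableEq a] [DecidableEq b] [DecidableEq a'] [DecidableEq b']

omit [DecidableEq a'] [DecidableEq b'] in
theorem LOCCSequence.splits_rounds (P : LOCCSequence a b a' b') (Y : Matrix b (R × a) ℂ) (r : ℕ) :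
    Splits Y (fun h : Hist P.n r => P.opB r h * Y * colAct R (P.opA r h)) := by
  induction r with
  | zero =>
    -- An embedding isometry is a measurement with a single outcome.
    have h1 : Splits Y (fun _ : Unit => P.VB * Y) :=
      splits_measure_left Y (M := fun _ : Unit => P.VB) (by simpa [IsMeasurement] using P.isometryB)
    have h2 : Splits (P.VB * Y) (fun _ : Unit => P.VB * Y * colAct R P.VA) := by
      refine splits_mul_right (P.VB * Y) (C := fun _ : Unit => colAct R P.VA)
        (sum_colAct (A := fun _ : Unit => P.VA) (by simpa [IsMeasurement] using P.isometryA))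
    refine ⟨fun m => ?_, ?_⟩
    · have h := h1.1 m
      rw [Fintype.sum_unique] at h
      exact h.trans (h2.1 m)
    · have h := h1.2
      rw [Fintype.sum_unique] at h
      exact h2.2.trans h
  | succ r ih =>
    refine ih.trans (κ := Fin (P.n r))
      (W := fun h j => P.opB (r + 1) (h, j) * Y * colAct R (P.opA (r + 1) (h, j))) fun h => ?_
    have e : ∀ j, P.opB (r + 1) (h, j) * Y * colAct R (P.opA (r + 1) (h, j)) =
        P.MB r h j * (P.opB r h * Y * colAct R (P.opA r h)) * colAct R (P.MA r h j) := by
      intro j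
      simp only [LOCCSequence.opB, LOCCSequence.opA, colAct_mul, Matrix.mul_assoc]
    simp only [e]
    rcases P.oneWay r with hA | hB
    · simp only [(hA h).2, Matrix.one_mul]
      exact splits_mul_right _ (sum_colAct (hA h).1)
    · simp only [(hB h).2, colAct_one, Matrix.mul_one]
      exact splits_measure_left _ (hB h).1

omit [DecidableEq a'] in
theorem LOCCSequence.splits (P : LOCCSequence a b a' b') (Y : Matrix b (R × a) ℂ) (r : ℕ) :
    Splits Y (fun p : (Hist P.n r × Fin (P.nA r)) × Fin (P.nB r) =>
      (P.FB r p.1.1 p.2 * P.opB r p.1.1) * Y * colAct R (P.FA r p.1.1 p.1.2 * P.opA r p.1.1)) := by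
  have h1 := (P.splits_rounds Y r).trans (κ := Fin (P.nA r))
    (W := fun h i => P.opB r h * Y * colAct R (P.opA r h) * colAct R (P.FA r h i))
    fun h => splits_mul_right _ (sum_colAct (P.finalA r h))
  have h2 := h1.trans (κ := Fin (P.nB r)) (W := fun (p : Hist P.n r × Fin (P.nA r)) j =>
    P.FB r p.1 j * (P.opB r p.1 * Y * colAct R (P.opA r p.1) * colAct R (P.FA r p.1 p.2)))
    fun p => splits_measure_left
      (P.opB r p.1 * Y * colAct R (P.opA r p.1) * colAct R (P.FA r p.1 p.2))
      (M := P.FB r p.1) (P.finalB r p.1)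
  have e : (fun p : (Hist P.n r × Fin (P.nA r)) × Fin (P.nB r) =>
      (P.FB r p.1.1 p.2 * P.opB r p.1.1) * Y * colAct R (P.FA r p.1.1 p.1.2 * P.opA r p.1.1)) =
      fun p => P.FB r p.1.1 p.2 *
        (P.opB r p.1.1 * Y * colAct R (P.opA r p.1.1) * colAct R (P.FA r p.1.1 p.1.2)) := by
    funext p
    simp only [colAct_mul, Matrix.mul_assoc]
  rw [e]
  exact h2

end Locc

/-! ### Pure states as bipartite matrices -/

section Vectors

variable {R a b : Type*}

/-- A vector on `R ⊗ (a ⊗ b)` as a bipartite vector between `b` and `R ⊗ a`. -/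
def vecMat (Ψ : R × (a × b) → ℂ) : Matrix b (R × a) ℂ := Matrix.of fun v u => Ψ (u.1, (u.2, v))

variable [Fintype R] [Fintype a] [Fintype b]

omit [Fintype b] in
theorem traceFst_traceFst_proj (Ψ : R × (a × b) → ℂ) :
    traceFst (traceFst (proj Ψ)) = vecMat Ψ * (vecMat Ψ)ᴴ := by
  ext v v'
  simp only [traceFst, proj, of_apply, vecMulVec_apply, vecMat, mul_apply, conjTranspose_apply,
    Pi.star_apply]
  rw [Fintype.sum_prod_type, Finset.sum_comm]

theorem trace_vecMat (Ψ : R × (a × b) → ℂ) :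
    (vecMat Ψ * (vecMat Ψ)ᴴ).trace = ((∑ i, ‖Ψ i‖ ^ 2 : ℝ) : ℂ) := by
  simp only [Matrix.trace, vecMat, diag_apply, mul_apply, of_apply, conjTranspose_apply]
  simp only [Complex.ofReal_sum, Complex.ofReal_pow, Fintype.sum_prod_type]
  rw [Finset.sum_comm]
  refine Finset.sum_congr rfl fun r _ => ?_
  rw [Finset.sum_comm]
  refine Finset.sum_congr rfl fun x _ => Finset.sum_congr rfl fun y _ => ?_
  exact Complex.mul_conj' _

/-- The vector `(1^R ⊗ T) Ψ`. -/
def applyVec {m m' : Type*} [Fintype m] (T : Matrix m' m ℂ) (Ψ : R × m → ℂ) : R × m' → ℂ :=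
  fun u => ∑ s, T u.2 s * Ψ (u.1, s)

theorem vecMat_applyVec_kronecker [DecidableEq R] {a' b' : Type*} (S : Matrix a' a ℂ)
    (T : Matrix b' b ℂ) (Ψ : R × (a × b) → ℂ) :
    vecMat (applyVec (S ⊗ₖ T) Ψ) = T * vecMat Ψ * colAct R S := by
  ext v u
  simp only [vecMat, applyVec, of_apply, mul_apply, colAct, transpose_apply, kroneckerMap_apply,
    Fintype.sum_prod_type, one_apply, ite_mul, one_mul, zero_mul, mul_ite, mul_zero]
  conv_rhs => rw [Finset.sum_comm]
  simp only [Finset.sum_ite_eq, Finset.mem_univ, if_true]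
  refine Finset.sum_congr rfl fun x _ => ?_
  rw [Finset.sum_mul]
  exact Finset.sum_congr rfl fun y _ => by ring

omit [Fintype R] in
-- Identifies the blockwise action of a Kraus operator, as in `idTensor`, with the action on the
-- vector, so each branch stays pure.
theorem mul_block_mul_conjTranspose {m m' : Type*} [Fintype m] (T : Matrix m' m ℂ)
    (Ψ : R × m → ℂ) (u v : R × m') :
    (T * (Matrix.of fun s t => proj Ψ (u.1, s) (v.1, t)) * Tᴴ) u.2 v.2 =
      proj (applyVec T Ψ) u v := by
  simp only [mul_apply, of_apply, proj, vecMulVec_apply, applyVec, conjTranspose_apply,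
    Pi.star_apply, star_sum, Finset.sum_mul, Finset.mul_sum, star_mul']
  refine Finset.sum_congr rfl fun x _ => Finset.sum_congr rfl fun y _ => by ring

theorem kyFan_vecMat_le_normalized [DecidableEq b] (Ψ : R × (a × b) → ℂ) (hne : Nonempty (R × (a × b))) :
    ∃ φ : R × (a × b) → ℂ, IsPureState φ ∧
      proj Ψ = ((∑ i, ‖Ψ i‖ ^ 2 : ℝ) : ℂ) • proj φ ∧
      ∀ m, kyFan m (vecMat Ψ * (vecMat Ψ)ᴴ) ≤
        (∑ i, ‖Ψ i‖ ^ 2) * kyFan m (vecMat φ * (vecMat φ)ᴴ) := by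
  classical
  have key : ∃ φ : R × (a × b) → ℂ, IsPureState φ ∧
      proj Ψ = ((∑ i, ‖Ψ i‖ ^ 2 : ℝ) : ℂ) • proj φ := by
    by_cases h0 : ∑ i, ‖Ψ i‖ ^ 2 = 0
    · obtain ⟨i₀⟩ := hne
      have hz : Ψ = 0 := by
        funext i
        have := (Finset.sum_eq_zero_iff_of_nonneg (fun i _ => sq_nonneg ‖Ψ i‖)).mp h0 i
          (Finset.mem_univ _)
        simpa using this
      -- A branch of probability zero still needs some unit vector; any basis vector will do.
      refine ⟨Pi.single i₀ 1, ?_, ?_⟩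
      · simp only [IsPureState]
        rw [Finset.sum_eq_single i₀]
        · simp
        · intro j _ hj; simp [Pi.single_eq_of_ne hj]
        · simp
      · rw [h0, hz]; ext; simp [proj, vecMulVec_apply]
    · set p := ∑ i, ‖Ψ i‖ ^ 2 with hp
      have hp0 : 0 < p := lt_of_le_of_ne (Finset.sum_nonneg fun i _ => sq_nonneg _) (Ne.symm h0)
      have hs : Real.sqrt p * Real.sqrt p = p := Real.mul_self_sqrt hp0.le
      have hsp : Real.sqrt p ≠ 0 := (Real.sqrt_pos.mpr hp0).ne'
      refine ⟨fun i => (((Real.sqrt p)⁻¹ : ℝ) : ℂ) * Ψ i, ?_, ?_⟩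
      · simp only [IsPureState, norm_mul, mul_pow, ← Finset.mul_sum, ← hp]
        rw [Complex.norm_real, Real.norm_eq_abs, sq_abs, sq, ← mul_inv, hs, inv_mul_cancel₀ h0]
      · ext i j
        simp only [proj, vecMulVec_apply, Pi.star_apply, Matrix.smul_apply, smul_eq_mul, star_mul',
          RCLike.star_def, Complex.conj_ofReal]
        have : ((p : ℝ) : ℂ) * (((Real.sqrt p)⁻¹ : ℝ) : ℂ) * (((Real.sqrt p)⁻¹ : ℝ) : ℂ) = 1 := by
          rw [← Complex.ofReal_mul, ← Complex.ofReal_mul, mul_assoc, ← mul_inv, hs,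
            mul_inv_cancel₀ h0, Complex.ofReal_one]
        linear_combination (-(Ψ i * (starRingEnd ℂ) (Ψ j))) * this
  obtain ⟨φ, hφ, h⟩ := key
  refine ⟨φ, hφ, h, fun m => ?_⟩
  have e : vecMat Ψ * (vecMat Ψ)ᴴ =
      ((∑ i, ‖Ψ i‖ ^ 2 : ℝ) : ℂ) • (vecMat φ * (vecMat φ)ᴴ) := by
    rw [← traceFst_traceFst_proj, ← traceFst_traceFst_proj, h]
    ext v v'
    simp [traceFst, Finset.mul_sum]
  rw [e]
  exact kyFan_smul_le (posSemidef_self_mul_conjTranspose _)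
    (Finset.sum_nonneg fun i _ => sq_nonneg _) m

end Vectors

theorem exists_eq_conjTranspose_mul_self {n : Type*} [Fintype n] [DecidableEq n]
    {P : Matrix n n ℂ} (hP : P.PosSemidef) : ∃ S : Matrix n n ℂ, P = Sᴴ * S := by
  obtain ⟨U, -, -, h⟩ := spectral_mul hP.1
  refine ⟨diagonal (fun i => ((Real.sqrt (hP.1.eigenvalues i) : ℝ) : ℂ)) * Uᴴ, ?_⟩
  have e : (diagonal (fun i => ((Real.sqrt (hP.1.eigenvalues i) : ℝ) : ℂ)))ᴴ *
      diagonal (fun i => ((Real.sqrt (hP.1.eigenvalues i) : ℝ) : ℂ)) =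
      diagonal (fun i => (hP.1.eigenvalues i : ℂ)) := by
    rw [diagonal_conjTranspose, diagonal_mul_diagonal]
    congr 1; ext i
    simp only [Pi.star_apply, RCLike.star_def, Complex.conj_ofReal]
    rw [← Complex.ofReal_mul, Real.mul_self_sqrt (hP.eigenvalues_nonneg i)]
  rw [conjTranspose_mul, conjTranspose_conjTranspose]
  conv_lhs => rw [h, ← e]
  simp only [Matrix.mul_assoc]

/-! ### Continuity of Ky Fan sums -/

section Frobenius

attribute [local instance] Matrix.frobeniusNormedAddCommGroup

theorem frobenius_norm_sq {m n : Type*} [Fintype m] [Fintype n] (A : Matrix m n ℂ) :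
    ‖A‖ ^ 2 = (A * Aᴴ).trace.re := by
  rw [frobenius_norm_def, ← Real.sqrt_eq_rpow, Real.sq_sqrt (by positivity)]
  simp only [Matrix.trace, diag_apply, mul_apply, conjTranspose_apply, Complex.re_sum]
  refine Finset.sum_congr rfl fun i _ => Finset.sum_congr rfl fun j _ => ?_
  rw [RCLike.star_def, Complex.mul_conj']
  norm_cast

/-- With `P = S†S` and `S` a contraction, `tr(P YY†) = ‖SY‖²`. A difference of squares of numbers in
`[0, 1]` is at most twice the difference of the numbers, whence the factor 2. -/
theorem trace_mul_le_add {b k : Type*} [Fintype b] [DecidableEq b] [Fintype k]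
    {P : Matrix b b ℂ} (hP : P.PosSemidef) (hP1 : (1 - P).PosSemidef) {Y Z : Matrix b k ℂ}
    (hY : (Y * Yᴴ).trace.re ≤ 1) (hZ : (Z * Zᴴ).trace.re ≤ 1) :
    (P * (Y * Yᴴ)).trace.re ≤
      (P * (Z * Zᴴ)).trace.re + 2 * Real.sqrt ((Y - Z) * (Y - Z)ᴴ).trace.re := by
  obtain ⟨S, hS⟩ := exists_eq_conjTranspose_mul_self hP
  have e : ∀ X : Matrix b k ℂ, (P * (X * Xᴴ)).trace.re = ‖S * X‖ ^ 2 := by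
    intro X
    rw [frobenius_norm_sq, hS, Matrix.mul_assoc, Matrix.trace_mul_comm, conjTranspose_mul]
    simp only [Matrix.mul_assoc]
  have hle : ∀ X : Matrix b k ℂ, ‖S * X‖ ≤ ‖X‖ := by
    intro X
    refine le_of_sq_le_sq ?_ (norm_nonneg _)
    rw [← e, frobenius_norm_sq]
    have h := (Complex.le_def.mp (hP1.conjTranspose_mul_mul_same X).trace_nonneg).1
    rw [Matrix.mul_assoc, Matrix.trace_mul_comm, Matrix.mul_assoc, Matrix.sub_mul, trace_sub,
      Matrix.one_mul] at h
    simpa using h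
  have hle1 : ∀ X : Matrix b k ℂ, (X * Xᴴ).trace.re ≤ 1 → ‖S * X‖ ≤ 1 := by
    intro X hX
    refine (hle X).trans (le_of_sq_le_sq ?_ zero_le_one)
    rw [frobenius_norm_sq]; simpa using hX
  have htri : ‖S * Y‖ ≤ ‖S * Z‖ + ‖Y - Z‖ := by
    calc ‖S * Y‖ = ‖S * Z + S * (Y - Z)‖ := by rw [Matrix.mul_sub]; simp
      _ ≤ ‖S * Z‖ + ‖S * (Y - Z)‖ := norm_add_le _ _
      _ ≤ _ := by gcongr; exact hle _
  rw [e, e, ← frobenius_norm_sq, Real.sqrt_sq (norm_nonneg _)]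
  nlinarith [hle1 Y hY, hle1 Z hZ, norm_nonneg (S * Y), norm_nonneg (S * Z), norm_nonneg (Y - Z)]

end Frobenius

section Continuity

variable {R a b : Type*} [Fintype R] [Fintype a] [Fintype b] [DecidableEq b]

omit [DecidableEq b] in
theorem trace_vecMat_of_isPureState {Ψ : R × (a × b) → ℂ} (h : IsPureState Ψ) :
    (vecMat Ψ * (vecMat Ψ)ᴴ).trace.re = 1 := by
  rw [trace_vecMat, Complex.ofReal_re]; exact h

theorem trace_mul_vecMat_le {P : Matrix b b ℂ} (hP : P.PosSemidef) (hP1 : (1 - P).PosSemidef)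
    {Ψ Φ : R × (a × b) → ℂ} (hΨ : IsPureState Ψ) (hΦ : IsPureState Φ) :
    (P * (vecMat Ψ * (vecMat Ψ)ᴴ)).trace.re ≤ (P * (vecMat Φ * (vecMat Φ)ᴴ)).trace.re +
      2 * Real.sqrt (∑ i, ‖Ψ i - Φ i‖ ^ 2) := by
  have h := trace_mul_le_add hP hP1 (trace_vecMat_of_isPureState hΨ).le
    (trace_vecMat_of_isPureState hΦ).le
  have e : vecMat Ψ - vecMat Φ = vecMat (fun i => Ψ i - Φ i) := rfl
  rwa [e, trace_vecMat, Complex.ofReal_re] at h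

theorem kyFan_vecMat_le {Ψ Φ : R × (a × b) → ℂ} (hΨ : IsPureState Ψ) (hΦ : IsPureState Φ) (m : ℕ) :
    kyFan m (vecMat Ψ * (vecMat Ψ)ᴴ) ≤ kyFan m (vecMat Φ * (vecMat Φ)ᴴ) +
      2 * Real.sqrt (∑ i, ‖Ψ i - Φ i‖ ^ 2) := by
  obtain ⟨P, hP, hP1, hPm, h⟩ := exists_trace_mul_eq_kyFan
    (posSemidef_self_mul_conjTranspose (vecMat Ψ)).1 m
  rw [← h]
  refine (trace_mul_vecMat_le hP hP1 hΨ hΦ).trans ?_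
  gcongr
  exact trace_mul_le_kyFan (posSemidef_self_mul_conjTranspose _) hP hP1 hPm

theorem continuousOn_kyFan_vecMat (m : ℕ) :
    ContinuousOn (fun Ψ : R × (a × b) → ℂ => kyFan m (vecMat Ψ * (vecMat Ψ)ᴴ))
      {Ψ | IsPureState Ψ} := by
  intro Φ hΦ
  have hg : Tendsto (fun Ψ : R × (a × b) → ℂ => 2 * Real.sqrt (∑ i, ‖Ψ i - Φ i‖ ^ 2))
      (𝓝[{Ψ | IsPureState Ψ}] Φ) (𝓝 0) := by
    have : Continuous fun Ψ : R × (a × b) → ℂ => 2 * Real.sqrt (∑ i, ‖Ψ i - Φ i‖ ^ 2) := by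
      fun_prop
    have h := this.tendsto Φ
    simp only [sub_self, norm_zero, ne_eq, OfNat.ofNat_ne_zero, not_false_eq_true, zero_pow,
      Finset.sum_const_zero, Real.sqrt_zero, mul_zero] at h
    exact h.mono_left nhdsWithin_le_nhds
  refine tendsto_iff_dist_tendsto_zero.mpr (squeeze_zero' (Eventually.of_forall fun _ => dist_nonneg)
    ?_ hg)
  filter_upwards [self_mem_nhdsWithin] with Ψ hΨ
  have h1 := kyFan_vecMat_le hΨ hΦ m
  have h2 := kyFan_vecMat_le hΦ hΨ m
  have e : ∑ i, ‖Φ i - Ψ i‖ ^ 2 = ∑ i, ‖Ψ i - Φ i‖ ^ 2 :=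
    Finset.sum_congr rfl fun i _ => by rw [norm_sub_rev]
  rw [e] at h2
  rw [Real.dist_eq, abs_le]
  constructor <;> linarith

theorem isCompact_isPureState (n : Type*) [Fintype n] : IsCompact {v : n → ℂ | IsPureState v} := by
  apply Metric.isCompact_of_isClosed_isBounded
  · exact isClosed_eq (by fun_prop) continuous_const
  · refine (Metric.isBounded_closedBall (x := (0 : n → ℂ)) (r := 1)).subset fun v hv => ?_
    rw [mem_closedBall_zero_iff, pi_norm_le_iff_of_nonneg zero_le_one]
    intro i
    have : ‖v i‖ ^ 2 ≤ 1 := by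
      rw [← (show ∑ i, ‖v i‖ ^ 2 = 1 from hv)]
      exact Finset.single_le_sum (fun j _ => sq_nonneg ‖v j‖) (Finset.mem_univ i)
    exact (sq_le_one_iff₀ (norm_nonneg _)).mp this

end Continuity

/-- By Carathéodory, `dim E + 1` points suffice, so the hull is a continuous image of a simplex
times a power of `s`. -/
theorem isCompact_convexHull {E : Type*} [NormedAddCommGroup E] [NormedSpace ℝ E]
    [FiniteDimensional ℝ E] {s : Set E} (hs : IsCompact s) : IsCompact (convexHull ℝ s) := by
  rcases s.eq_empty_or_nonempty with rfl | ⟨s₀, hs₀⟩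
  · simp
  set d := Module.finrank ℝ E + 1
  have h : convexHull ℝ s = (fun q : (Fin d → ℝ) × (Fin d → E) => ∑ i, q.1 i • q.2 i) ''
      (stdSimplex ℝ (Fin d) ×ˢ Set.univ.pi fun _ => s) := by
    apply Set.Subset.antisymm
    · intro x hx
      obtain ⟨ι, _, z, w, hz, hai, hw, hw1, hx⟩ := eq_pos_convex_span_of_mem_convexHull hx
      have hcard : Fintype.card ι ≤ Fintype.card (Fin d) := by
        rw [Fintype.card_fin]
        exact hai.card_le_finrank_succ.trans (Nat.succ_le_succ (Submodule.finrank_le _))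
      obtain ⟨e⟩ := Function.Embedding.nonempty_of_card_le hcard
      -- Unused slots get weight zero and the arbitrary point `s₀`.
      refine ⟨(Function.extend e w 0, Function.extend e z fun _ => s₀), ⟨⟨fun j => ?_, ?_⟩, ?_⟩, ?_⟩
      · by_cases hj : ∃ i, e i = j
        · obtain ⟨i, rfl⟩ := hj
          simpa only [e.injective.extend_apply] using (hw i).le
        · simp [Function.extend_apply' _ _ _ hj]
      · rw [← hw1]
        symm
        refine Fintype.sum_of_injective e e.injective _ _ (fun j hj => ?_) fun i => ?_
        · exact Function.extend_apply' _ _ _ (by simpa using hj)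
        · simp only [e.injective.extend_apply]
      · intro j _
        by_cases hj : ∃ i, e i = j
        · obtain ⟨i, rfl⟩ := hj
          simpa only [e.injective.extend_apply] using hz ⟨i, rfl⟩
        · simpa only [Function.extend_apply' _ _ _ hj] using hs₀
      · rw [← hx]
        symm
        refine Fintype.sum_of_injective e e.injective _ _ (fun j hj => ?_) fun i => ?_
        · simp only [Function.extend_apply' w (0 : Fin d → ℝ) j (by simpa using hj),
            Pi.zero_apply, zero_smul]
        · simp only [e.injective.extend_apply]
    · rintro x ⟨⟨w, z⟩, ⟨hw, hz⟩, rfl⟩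
      exact mem_convexHull_of_exists_fintype w z hw.1 hw.2 (fun i => hz i trivial) rfl
  rw [h]
  refine ((isCompact_stdSimplex ℝ (Fin d)).prod (isCompact_univ_pi fun _ => hs)).image ?_
  fun_prop

/-! ### Fidelity of an ensemble with a pure state -/

section Fidelity

variable {n : Type*} [Fintype n]

theorem fidelitySqPure_sum_smul_proj {ι : Type*} [Fintype ι] (p : ι → ℝ) (Ψ : ι → n → ℂ)
    (t : n → ℂ) : fidelitySqPure (∑ j, (p j : ℂ) • proj (Ψ j)) t =
      ∑ j, p j * ‖star t ⬝ᵥ Ψ j‖ ^ 2 := by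
  rw [fidelitySqPure, sum_mulVec, dotProduct_sum, Complex.re_sum]
  refine Finset.sum_congr rfl fun j _ => ?_
  rw [smul_mulVec, dotProduct_smul, smul_eq_mul, Complex.re_ofReal_mul, proj,
    vecMulVec_mulVec, dotProduct_smul]
  congr 1
  have : star (Ψ j) ⬝ᵥ t = star (star t ⬝ᵥ Ψ j) := by
    simp [dotProduct, mul_comm]
  rw [this]
  rw [op_smul_eq_smul, smul_eq_mul, mul_comm, RCLike.star_def, Complex.mul_conj']
  norm_cast

theorem continuous_fidelitySqPure (t : n → ℂ) : Continuous fun ρ : Matrix n n ℂ => fidelitySqPure ρ t := by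
  unfold fidelitySqPure
  fun_prop

end Fidelity

/-! ### Reduced states of the initial and target vectors -/

section Resource

theorem posSemidef_maxMixed (K M : ℕ) : (maxMixed K M).PosSemidef := by
  refine PosSemidef.diagonal fun l => ?_
  simp only [Pi.zero_apply]
  split_ifs
  · exact_mod_cast inv_nonneg.mpr (Nat.cast_nonneg K)
  · exact le_rfl

theorem trace_maxMixed {K M : ℕ} (hK : 1 ≤ K) (hKM : K ≤ M) : (maxMixed K M).trace = 1 := by
  rw [maxMixed, trace_diagonal, Finset.sum_ite, Finset.sum_const_zero, add_zero, Finset.sum_const]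
  have h : (Finset.filter (fun l : Fin M => l.val < K) Finset.univ).card = K := by
    rw [Fin.card_filter_val_lt]; omega
  rw [h, nsmul_eq_mul]
  push_cast
  exact mul_inv_cancel₀ (by exact_mod_cast (by omega : K ≠ 0))

theorem sum_maxEnt_mul_star {K N M : ℕ} (hKN : K ≤ N) (l l' : Fin M) :
    ∑ n : Fin N, maxEnt K N M (n, l) * star (maxEnt K N M (n, l')) = maxMixed K M l l' := by
  have hc : (((Real.sqrt K)⁻¹ : ℝ) : ℂ) * (((Real.sqrt K)⁻¹ : ℝ) : ℂ) = (((K : ℝ)⁻¹ : ℝ) : ℂ) := by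
    rw [← Complex.ofReal_mul, ← mul_inv, Real.mul_self_sqrt (Nat.cast_nonneg K)]
  simp only [maxEnt, maxMixed, diagonal_apply]
  by_cases hl : l.val < K
  · rw [Finset.sum_eq_single (⟨l.val, hl.trans_le hKN⟩ : Fin N)]
    · by_cases h : l = l'
      · subst h
        simp only [hl, and_self, if_true, RCLike.star_def, Complex.conj_ofReal, hc]
      · have : l.val ≠ l'.val := fun e => h (Fin.ext e)
        simp [h, this]
    · intro n _ hn
      have : n.val ≠ l.val := fun e => hn (Fin.ext e)
      simp [this]
    · simp
  · rw [Finset.sum_eq_zero]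
    · split_ifs <;> rfl
    · intro n _
      have : ¬ (n.val = l.val ∧ n.val < K) := fun h => hl (h.1 ▸ h.2)
      simp [this]

variable {R A B : Type*} [Fintype R] [Fintype A] [Fintype B]

theorem trace_reducedAB (ψ : R × A × B → ℂ) :
    (reducedAB ψ).trace = ((∑ i, ‖ψ i‖ ^ 2 : ℝ) : ℂ) := by
  simp only [reducedAB, traceFst, proj, Matrix.trace, diag_apply, of_apply, vecMulVec_apply,
    Pi.star_apply]
  rw [Fintype.sum_prod_type (f := fun i => ‖ψ i‖ ^ 2), Finset.sum_comm]
  push_cast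
  exact Finset.sum_congr rfl fun r _ => Finset.sum_congr rfl fun x _ => Complex.mul_conj' _

theorem trace_traceFst {m n : Type*} [Fintype m] [Fintype n] (ρ : Matrix (m × n) (m × n) ℂ) :
    (traceFst ρ).trace = ρ.trace := by
  simp only [traceFst, Matrix.trace, diag_apply, of_apply, Fintype.sum_prod_type]
  exact Finset.sum_comm

theorem trace_reducedB (ψ : R × A × B → ℂ) :
    (reducedB ψ).trace = ((∑ i, ‖ψ i‖ ^ 2 : ℝ) : ℂ) := by
  rw [reducedB, trace_traceFst, trace_reducedAB]

omit [Fintype B] in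
theorem vecMat_initialVec (ψ : R × A × B → ℂ) {K N M : ℕ} (hKN : K ≤ N) :
    vecMat (initialVec ψ K N M) * (vecMat (initialVec ψ K N M))ᴴ =
      reducedB ψ ⊗ₖ maxMixed K M := by
  ext u v
  rw [kroneckerMap_apply, ← sum_maxEnt_mul_star hKN]
  simp only [vecMat, initialVec, mul_apply, of_apply, conjTranspose_apply, reducedB, reducedAB,
    traceFst, proj, vecMulVec_apply, Pi.star_apply, Fintype.sum_prod_type, star_mul']
  rw [Finset.sum_comm, Finset.sum_mul]
  refine Finset.sum_congr rfl fun x _ => ?_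
  rw [Finset.sum_mul]
  refine Finset.sum_congr rfl fun r _ => ?_
  rw [Finset.mul_sum]
  exact Finset.sum_congr rfl fun n _ => by ring

omit [Fintype A] [Fintype B] in
theorem vecMat_targetVec (ψ : R × A × B → ℂ) {L N M : ℕ} (hLN : L ≤ N) :
    vecMat (targetVec ψ L N M) * (vecMat (targetVec ψ L N M))ᴴ =
      (reducedAB ψ ⊗ₖ maxMixed L M).submatrix (Equiv.prodAssoc A B (Fin M)).symm
        (Equiv.prodAssoc A B (Fin M)).symm := by
  ext u v
  rw [submatrix_apply, kroneckerMap_apply, ← sum_maxEnt_mul_star hLN]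
  simp only [vecMat, targetVec, mul_apply, of_apply, conjTranspose_apply, reducedAB,
    traceFst, proj, vecMulVec_apply, Pi.star_apply, Fintype.sum_prod_type, star_mul',
    Equiv.prodAssoc_symm_apply]
  rw [Finset.sum_mul]
  refine Finset.sum_congr rfl fun r _ => ?_
  rw [Finset.mul_sum]
  exact Finset.sum_congr rfl fun n _ => by ring

theorem isPureState_initialVec {ψ : R × A × B → ℂ} (hψ : IsPureState ψ) {K N M : ℕ} (hK : 1 ≤ K)
    (hKN : K ≤ N) (hKM : K ≤ M) : IsPureState (initialVec ψ K N M) := by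
  have h := trace_vecMat (initialVec ψ K N M)
  rw [vecMat_initialVec ψ hKN, trace_kronecker, trace_maxMixed hK hKM, trace_reducedB,
    show ∑ i, ‖ψ i‖ ^ 2 = 1 from hψ] at h
  have := congrArg Complex.re h
  rw [Complex.ofReal_re] at this
  simpa [IsPureState] using this.symm

theorem isPureState_targetVec {ψ : R × A × B → ℂ} (hψ : IsPureState ψ) {L N M : ℕ} (hL : 1 ≤ L)
    (hLN : L ≤ N) (hLM : L ≤ M) : IsPureState (targetVec ψ L N M) := by
  have h := trace_vecMat (targetVec ψ L N M)
  have e : ((reducedAB ψ ⊗ₖ maxMixed L M).submatrix (Equiv.prodAssoc A B (Fin M)).symm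
        (Equiv.prodAssoc A B (Fin M)).symm).trace = (reducedAB ψ ⊗ₖ maxMixed L M).trace :=
    Equiv.sum_comp (Equiv.prodAssoc A B (Fin M)).symm fun i => (reducedAB ψ ⊗ₖ maxMixed L M) i i
  rw [vecMat_targetVec ψ hLN, e, trace_kronecker, trace_maxMixed hL hLM, trace_reducedAB,
    show ∑ i, ‖ψ i‖ ^ 2 = 1 from hψ] at h
  have := congrArg Complex.re h
  rw [Complex.ofReal_re] at this
  simpa [IsPureState] using this.symm

end Resource

/-! ### From LOCC protocols to finite ensembles -/

section Feasibility

variable {R A B : Type*} [Fintype R] [Fintype A] [Fintype B] [DecidableEq A] [DecidableEq B]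

/-- The first Ky Fan sums of the reduced state of `φ`, and its squared overlap with `t`. -/
def kyFanOverlap {R a b : Type*} [Fintype R] [Fintype a] [Fintype b] [DecidableEq b] (D : ℕ)
    (t φ : R × (a × b) → ℂ) : (Fin D → ℝ) × ℝ :=
  (fun m => kyFan m (vecMat φ * (vecMat φ)ᴴ), ‖star t ⬝ᵥ φ‖ ^ 2)

theorem isCompact_convexHull_kyFanOverlap {R a b : Type*} [Fintype R] [Fintype a] [Fintype b]
    [DecidableEq b] (D : ℕ) (t : R × (a × b) → ℂ) :
    IsCompact (convexHull ℝ (kyFanOverlap D t '' {φ | IsPureState φ})) := by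
  refine isCompact_convexHull ((isCompact_isPureState _).image_of_continuousOn ?_)
  refine ContinuousOn.prodMk (continuousOn_pi.mpr fun m => continuousOn_kyFan_vecMat _) ?_
  have : Continuous fun φ : R × (a × b) → ℂ => ‖star t ⬝ᵥ φ‖ ^ 2 := by fun_prop
  exact this.continuousOn

/-- A convex combination of points of the image is an ensemble. The indices `0, …, D` account for
the `+ 1` in the number of Ky Fan sums; equality of the totals is automatic from normalization. -/
theorem feasible_of_mem_convexHull {ψ : R × A × B → ℂ} (hψ : IsPureState ψ) {ε : ℝ}
    {K L N M : ℕ} (hK : 1 ≤ K) (hL : 1 ≤ L) (hKNM : K ≤ N ∧ K ≤ M) (hLNM : L ≤ N ∧ L ≤ M)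
    {x : (Fin (Fintype.card (A × B × Fin M) + 1) → ℝ) × ℝ}
    (hx : x ∈ convexHull ℝ (kyFanOverlap _ (targetVec ψ L N M) '' {φ | IsPureState φ}))
    (hx1 : ∀ m : Fin (Fintype.card (A × B × Fin M) + 1), kyFan m (reducedB ψ ⊗ₖ maxMixed K M) ≤ x.1 m) (hx2 : 1 - ε ^ 2 ≤ x.2) :
    Feasible ψ ε K L := by
  obtain ⟨ι, _, w, z, hw, hw1, hz, rfl⟩ := mem_convexHull_iff_exists_fintype.mp hx
  choose φ hφ hφz using hz
  obtain rfl : (fun i => kyFanOverlap _ (targetVec ψ L N M) (φ i)) = z := funext hφz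
  set e := (Fintype.equivFin ι).symm
  have hA : Nonempty A := by
    by_contra hne
    rw [not_nonempty_iff] at hne
    have : ∑ i, ‖ψ i‖ ^ 2 = 1 := hψ
    simp at this
  -- Ensures that the first `D` entries of the padded initial spectrum contain all its eigenvalues,
  -- so that they sum to the trace.
  have hcard : Fintype.card (B × Fin M) ≤ Fintype.card (A × B × Fin M) := by
    rw [Fintype.card_prod A]
    exact Nat.le_mul_of_pos_left _ Fintype.card_pos
  have hsum : ∀ m, ∑ l ∈ Finset.range m,
      ∑ j, w (e j) * spec (traceFst (traceFst (proj (φ (e j))))) l =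
      ∑ i, w i * kyFan m (vecMat (φ i) * (vecMat (φ i))ᴴ) := by
    intro m
    rw [Finset.sum_comm, ← Equiv.sum_comp e]
    refine Finset.sum_congr rfl fun j _ => ?_
    rw [← Finset.mul_sum, traceFst_traceFst_proj]
    rfl
  refine ⟨hK, hL, N, M, hKNM, hLNM, Fintype.card ι, fun j => w (e j), fun j => φ (e j),
    fun j => hw _, ?_, fun j => hφ _, ⟨fun m hm => ?_, ?_⟩, ?_⟩
  · rw [← hw1]; exact Equiv.sum_comp e w
  · rw [hsum]
    have := hx1 ⟨m, Nat.lt_succ_of_le hm⟩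
    change kyFan m _ ≤ _
    simpa [kyFanOverlap, Prod.fst_sum, Finset.sum_apply] using this
  · rw [hsum]
    have h0 := posSemidef_self_mul_conjTranspose (vecMat (initialVec ψ K N M))
    have h1 := trace_vecMat_of_isPureState (isPureState_initialVec hψ hK hKNM.1 hKNM.2)
    rw [vecMat_initialVec ψ hKNM.1] at h0 h1
    have h2 : ∀ i, kyFan (Fintype.card (A × B × Fin M)) (vecMat (φ i) * (vecMat (φ i))ᴴ) = 1 := by
      intro i
      rw [kyFan_eq_trace (posSemidef_self_mul_conjTranspose _).1 le_rfl]
      exact trace_vecMat_of_isPureState (hφ i)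
    simp only [h2, mul_one, hw1]
    rw [← h1]
    exact kyFan_eq_trace h0.1 hcard
  · rw [fidelitySqPure_sum_smul_proj]
    refine hx2.trans (le_of_eq ?_)
    rw [← Equiv.sum_comp e]
    simp [kyFanOverlap, Prod.snd_sum]

theorem tendsto_idTensor {R a b a' b' : Type*} [Fintype R] [Fintype a] [Fintype b] [Fintype a']
    [Fintype b'] [DecidableEq a] [DecidableEq b] (P : LOCCSequence a b a' b')
    {E : Matrix (a × b) (a × b) ℂ →ₗ[ℂ] Matrix (a' × b') (a' × b') ℂ}
    (hE : ∀ ρ, Tendsto (fun r => P.roundMap r ρ) atTop (𝓝 (E ρ))) (Ψ : R × (a × b) → ℂ) :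
    Tendsto (fun r => ∑ p : (Hist P.n r × Fin (P.nA r)) × Fin (P.nB r),
      proj (applyVec (P.op r p.1.1 p.1.2 p.2) Ψ)) atTop (𝓝 (idTensor R E (proj Ψ))) := by
  refine tendsto_pi_nhds.mpr fun u => tendsto_pi_nhds.mpr fun v => ?_
  have h := tendsto_pi_nhds.mp (tendsto_pi_nhds.mp
    (hE (Matrix.of fun s t => proj Ψ (u.1, s) (v.1, t))) u.2) v.2
  refine h.congr fun r => ?_
  simp only [LOCCSequence.roundMap, Matrix.sum_apply, Fintype.sum_prod_type]
  exact Finset.sum_congr rfl fun _ _ => Finset.sum_congr rfl fun _ _ =>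
    Finset.sum_congr rfl fun _ _ => mul_block_mul_conjTranspose _ _ _ _

/-- The ensemble consists of the normalized branch vectors, weighted by their squared norms. -/
theorem LOCCSequence.exists_mem_convexHull {R a b a' b' : Type*} [Fintype R] [Fintype a]
    [Fintype b] [Fintype a'] [Fintype b'] [DecidableEq a] [DecidableEq b] [DecidableEq b']
    (P : LOCCSequence a b a' b') {Ψ : R × (a × b) → ℂ} (hΨ : IsPureState Ψ)
    (hne : Nonempty (R × (a' × b'))) (t : R × (a' × b') → ℂ) (D r : ℕ) :
    ∃ x ∈ convexHull ℝ (kyFanOverlap D t '' {φ | IsPureState φ}),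
      (∀ m : Fin D, kyFan m (vecMat Ψ * (vecMat Ψ)ᴴ) ≤ x.1 m) ∧
      x.2 = fidelitySqPure (∑ p : (Hist P.n r × Fin (P.nA r)) × Fin (P.nB r),
        proj (applyVec (P.op r p.1.1 p.1.2 p.2) Ψ)) t := by
  classical
  have hs := P.splits (vecMat Ψ) r
  have hop : ∀ p : (Hist P.n r × Fin (P.nA r)) × Fin (P.nB r),
      (P.FB r p.1.1 p.2 * P.opB r p.1.1) * vecMat Ψ * colAct R (P.FA r p.1.1 p.1.2 * P.opA r p.1.1)
      = vecMat (applyVec (P.op r p.1.1 p.1.2 p.2) Ψ) :=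
    fun p => (vecMat_applyVec_kronecker _ _ _).symm
  simp only [hop] at hs
  choose φ hφ hproj hle using fun p : (Hist P.n r × Fin (P.nA r)) × Fin (P.nB r) =>
    kyFan_vecMat_le_normalized (applyVec (P.op r p.1.1 p.1.2 p.2) Ψ) hne
  set w := fun p : (Hist P.n r × Fin (P.nA r)) × Fin (P.nB r) =>
    ∑ i, ‖applyVec (P.op r p.1.1 p.1.2 p.2) Ψ i‖ ^ 2 with hw
  have hw1 : ∑ p, w p = 1 := by
    have h := congrArg Complex.re hs.2
    rw [trace_vecMat_of_isPureState hΨ, Complex.re_sum] at h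
    simpa only [trace_vecMat, Complex.ofReal_re] using h
  refine ⟨∑ p, w p • kyFanOverlap D t (φ p), ?_, fun m => ?_, ?_⟩
  · exact mem_convexHull_of_exists_fintype w _
      (fun p => Finset.sum_nonneg fun i _ => sq_nonneg _) hw1 (fun p => ⟨φ p, hφ p, rfl⟩) rfl
  · refine (hs.1 m).trans ((Finset.sum_le_sum fun p _ => hle p m).trans (le_of_eq ?_))
    simp [kyFanOverlap, Prod.fst_sum, Finset.sum_apply, hw]
  · simp only [hproj]
    rw [fidelitySqPure_sum_smul_proj]
    simp [kyFanOverlap, Prod.snd_sum, hw]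

theorem IsApproxMerging.feasible {ψ : R × A × B → ℂ} (hψ : IsPureState ψ) {ε : ℝ} {K L N M : ℕ}
    {E : Matrix ((A × Fin N) × (B × Fin M)) ((A × Fin N) × (B × Fin M)) ℂ →ₗ[ℂ]
      Matrix (Fin N × (A × B × Fin M)) (Fin N × (A × B × Fin M)) ℂ}
    (h : IsApproxMerging ψ ε K L N M E) : Feasible ψ ε K L := by
  obtain ⟨P, hP⟩ := h.locc
  have hinit := isPureState_initialVec hψ h.K_pos h.K_le.1 h.K_le.2
  have hne : Nonempty (R × (Fin N × (A × B × Fin M))) := by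
    by_contra hne
    rw [not_nonempty_iff] at hne
    have : ∑ i, ‖targetVec ψ L N M i‖ ^ 2 = 1 :=
      isPureState_targetVec hψ h.L_pos h.L_le.1 h.L_le.2
    simp [Finset.univ_eq_empty] at this
  choose x hx hx1 hx2 using fun r => P.exists_mem_convexHull hinit hne (targetVec ψ L N M)
    (Fintype.card (A × B × Fin M) + 1) r
  -- A subsequence suffices: the Ky Fan inequalities are closed conditions, and the overlaps
  -- converge to the fidelity of the limit map along the whole sequence.
  obtain ⟨y, hy, f, hf, hlim⟩ := (isCompact_convexHull_kyFanOverlap _ _).tendsto_subseq hx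
  refine feasible_of_mem_convexHull hψ h.K_pos h.L_pos h.K_le h.L_le hy (fun m => ?_) ?_
  · have h1 : Tendsto (fun r => (x (f r)).1 m) atTop (𝓝 (y.1 m)) :=
      (tendsto_pi_nhds.mp ((continuous_fst.tendsto y).comp hlim)) m
    refine ge_of_tendsto' h1 fun r => ?_
    rw [← vecMat_initialVec ψ h.K_le.1]
    exact hx1 _ m
  · have h1 : Tendsto (fun r => (x (f r)).2) atTop (𝓝 y.2) := (continuous_snd.tendsto y).comp hlim
    have h2 := (((continuous_fidelitySqPure (targetVec ψ L N M)).tendsto _).comp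
      (tendsto_idTensor P hP (initialVec ψ K N M))).comp hf.tendsto_atTop
    have h3 := tendsto_nhds_unique h1 (h2.congr fun r => (hx2 (f r)).symm)
    rw [h3]
    exact h.fidelity

end Feasibility

/-! ### Largest eigenvalues and tensoring with a maximally mixed state -/

section LargestEigenvalue

variable {n : Type*} [Fintype n] [DecidableEq n]

theorem posSemidef_kyFan_one_smul_sub {ρ : Matrix n n ℂ} (hρ : ρ.PosSemidef) :
    (((kyFan 1 ρ : ℝ) : ℂ) • (1 : Matrix n n ℂ) - ρ).PosSemidef := by
  obtain ⟨U, hU, hU', h⟩ := spectral_mul hρ.1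
  have hd : (diagonal fun i => ((kyFan 1 ρ - hρ.1.eigenvalues i : ℝ) : ℂ)).PosSemidef := by
    refine PosSemidef.diagonal fun i => ?_
    rw [Pi.zero_apply]
    have : hρ.1.eigenvalues i ≤ kyFan 1 ρ := by
      rw [← spec_eigIndex hρ.1, kyFan, Finset.sum_range_one]
      exact (spec_antitone_nonneg hρ).1 (Nat.zero_le _)
    exact Complex.zero_le_real.mpr (sub_nonneg.mpr this)
  have e : ((kyFan 1 ρ : ℝ) : ℂ) • (1 : Matrix n n ℂ) - ρ =
      U * (diagonal fun i => ((kyFan 1 ρ - hρ.1.eigenvalues i : ℝ) : ℂ)) * Uᴴ := by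
    have e1 : (diagonal fun i => ((kyFan 1 ρ - hρ.1.eigenvalues i : ℝ) : ℂ)) =
        ((kyFan 1 ρ : ℝ) : ℂ) • (1 : Matrix n n ℂ) -
          diagonal fun i => (hρ.1.eigenvalues i : ℂ) := by
      ext i j
      by_cases hij : i = j
      · subst hij; simp
      · simp [hij]
    rw [e1, Matrix.mul_sub, Matrix.sub_mul, ← h]
    simp [hU']
  rw [e]
  exact hd.mul_mul_conjTranspose_same U

theorem trace_mul_re_nonneg {P X : Matrix n n ℂ} (hP : P.PosSemidef) (hX : X.PosSemidef) :
    0 ≤ (P * X).trace.re := by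
  obtain ⟨S, rfl⟩ := exists_eq_conjTranspose_mul_self hP
  rw [Matrix.mul_assoc, Matrix.trace_mul_comm]
  exact (Complex.le_def.mp (hX.mul_mul_conjTranspose_same S).trace_nonneg).1

theorem trace_mul_le_of_le_smul {P X : Matrix n n ℂ} (hP : P.PosSemidef) {c : ℝ}
    (hX : ((c : ℂ) • (1 : Matrix n n ℂ) - X).PosSemidef) :
    (P * X).trace.re ≤ c * P.trace.re := by
  have h := trace_mul_re_nonneg hP hX
  rw [Matrix.mul_sub, trace_sub, Matrix.mul_smul, trace_smul, Matrix.mul_one, smul_eq_mul,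
    Complex.sub_re, Complex.re_ofReal_mul] at h
  linarith

theorem kyFan_one_pos {ρ : Matrix n n ℂ} (hρ : ρ.PosSemidef) (h1 : ρ.trace.re = 1) :
    0 < kyFan 1 ρ := by
  by_contra h
  have h0 : kyFan 1 ρ = 0 := le_antisymm (not_lt.mp h)
    (Finset.sum_nonneg fun k _ => (spec_antitone_nonneg hρ).2 k)
  have := trace_mul_le_of_le_smul PosSemidef.one (posSemidef_kyFan_one_smul_sub hρ)
  rw [Matrix.one_mul, h1, h0, zero_mul] at this
  linarith

omit [Fintype n] [DecidableEq n] in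
theorem sub_kronecker {m : Type*} (P P' : Matrix n n ℂ) (Q : Matrix m m ℂ) :
    (P - P') ⊗ₖ Q = P ⊗ₖ Q - P' ⊗ₖ Q := by
  ext; simp [sub_mul]

omit [Fintype n] [DecidableEq n] in
theorem kronecker_sub {m : Type*} (P : Matrix n n ℂ) (Q Q' : Matrix m m ℂ) :
    P ⊗ₖ (Q - Q') = P ⊗ₖ Q - P ⊗ₖ Q' := by
  ext; simp [mul_sub]

theorem posSemidef_one_sub_kronecker {m : Type*} [Fintype m] [DecidableEq m]
    {P : Matrix n n ℂ} {Q : Matrix m m ℂ} (hP1 : (1 - P).PosSemidef) (hQ : Q.PosSemidef)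
    (hQ1 : (1 - Q).PosSemidef) : (1 - P ⊗ₖ Q).PosSemidef := by
  have e : 1 - P ⊗ₖ Q = (1 - P) ⊗ₖ Q + (1 : Matrix n n ℂ) ⊗ₖ (1 - Q) := by
    rw [sub_kronecker, kronecker_sub, one_kronecker_one]; abel
  rw [e]
  exact (hP1.kronecker hQ).add (PosSemidef.one.kronecker hQ1)

theorem smul_maxMixed_projection {K M : ℕ} (hK : 1 ≤ K) :
    (1 - (K : ℂ) • maxMixed K M).PosSemidef ∧
      (K : ℂ) • (maxMixed K M * maxMixed K M) = maxMixed K M := by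
  have hK0 : (K : ℂ) ≠ 0 := by exact_mod_cast (by omega : K ≠ 0)
  have h2 : (K : ℂ) • (maxMixed K M * maxMixed K M) = maxMixed K M := by
    rw [maxMixed, diagonal_mul_diagonal, ← diagonal_smul]
    congr 1; ext l
    simp only [Pi.smul_apply, smul_eq_mul]
    split_ifs
    · push_cast; field_simp
    · simp
  refine ⟨(posSemidef_of_isHermitian_of_mul_self ?_ ?_).2, h2⟩
  · rw [conjTranspose_smul, (posSemidef_maxMixed K M).1]; simp
  · rw [Matrix.smul_mul, Matrix.mul_smul, h2]

/-- The test operator is the optimal one for `ρ` tensored with the support projection `K • maxMixed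
K M`, which has trace `K`. -/
theorem kyFan_one_le_kyFan_kronecker_maxMixed {ρ : Matrix n n ℂ} (hρ : ρ.PosSemidef) {K M : ℕ}
    (hK : 1 ≤ K) (hKM : K ≤ M) : kyFan 1 ρ ≤ kyFan K (ρ ⊗ₖ maxMixed K M) := by
  obtain ⟨P, hP, hP1, hPm, h⟩ := exists_trace_mul_eq_kyFan hρ.1 1
  have hD := smul_maxMixed_projection (M := M) hK
  have hD0 : ((K : ℂ) • maxMixed K M).PosSemidef :=
    (posSemidef_maxMixed K M).smul (by exact_mod_cast Nat.zero_le K)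
  have htr : (P ⊗ₖ ((K : ℂ) • maxMixed K M)).trace.re ≤ (K : ℝ) := by
    rw [trace_kronecker, trace_smul, trace_maxMixed hK hKM, smul_eq_mul, mul_one, mul_comm,
      ← Complex.ofReal_natCast, Complex.re_ofReal_mul]
    exact mul_le_of_le_one_right (Nat.cast_nonneg K) (by exact_mod_cast hPm)
  have key := trace_mul_le_kyFan (hρ.kronecker (posSemidef_maxMixed K M)) (hP.kronecker hD0)
    (posSemidef_one_sub_kronecker hP1 hD0 hD.1) htr
  rwa [← mul_kronecker_mul, Matrix.smul_mul, hD.2, trace_kronecker, trace_maxMixed hK hKM, mul_one,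
    h] at key

theorem posSemidef_smul_one_sub_kronecker_maxMixed {ρ : Matrix n n ℂ} {c : ℝ} (hc : 0 ≤ c)
    (h : ((c : ℂ) • (1 : Matrix n n ℂ) - ρ).PosSemidef) {L M : ℕ} (hL : 1 ≤ L) :
    (((c / L : ℝ) : ℂ) • (1 : Matrix (n × Fin M) (n × Fin M) ℂ) - ρ ⊗ₖ maxMixed L M).PosSemidef := by
  have hL0 : (L : ℂ) ≠ 0 := by exact_mod_cast (by omega : L ≠ 0)
  have e : ((c / L : ℝ) : ℂ) • (1 : Matrix (n × Fin M) (n × Fin M) ℂ) - ρ ⊗ₖ maxMixed L M =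
      ((c : ℂ) • (1 : Matrix n n ℂ) - ρ) ⊗ₖ maxMixed L M +
        ((c / L : ℝ) : ℂ) • ((1 : Matrix n n ℂ) ⊗ₖ (1 - (L : ℂ) • maxMixed L M)) := by
    rw [sub_kronecker, kronecker_sub, one_kronecker_one, smul_kronecker, kronecker_smul, smul_sub,
      smul_smul]
    have : ((c / L : ℝ) : ℂ) * L = c := by push_cast; field_simp
    rw [this]; abel
  rw [e]
  refine (h.kronecker (posSemidef_maxMixed L M)).add (PosSemidef.smul
    (PosSemidef.one.kronecker (smul_maxMixed_projection hL).1) ?_)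
  exact_mod_cast div_nonneg hc (Nat.cast_nonneg L)

end LargestEigenvalue

/-! ### Lower bound on the converse quantity -/

section Converse

theorem exists_phase {n : Type*} [Fintype n] {t Ψ : n → ℂ} (ht : IsPureState t)
    (hΨ : IsPureState Ψ) : ∃ u : ℂ, ‖u‖ = 1 ∧
      ∑ i, ‖Ψ i - u * t i‖ ^ 2 ≤ 2 * (1 - ‖star t ⬝ᵥ Ψ‖ ^ 2) := by
  set z := star t ⬝ᵥ Ψ with hz
  obtain ⟨u, hu, huz⟩ : ∃ u : ℂ, ‖u‖ = 1 ∧ star u * z = (‖z‖ : ℂ) := by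
    by_cases h0 : z = 0
    · exact ⟨1, by simp, by simp [h0]⟩
    · refine ⟨z / ‖z‖, ?_, ?_⟩
      · simp [h0]
      · have hn : ((‖z‖ : ℝ) : ℂ) ≠ 0 := by simpa using h0
        rw [RCLike.star_def, map_div₀, Complex.conj_ofReal, div_mul_eq_mul_div, Complex.conj_mul',
          sq, mul_div_assoc, div_self hn, mul_one]
  have hexp : ∑ i, ‖Ψ i - u * t i‖ ^ 2 = 2 - 2 * ‖z‖ := by
    have h1 : ∀ i, ‖Ψ i - u * t i‖ ^ 2 =
        ‖Ψ i‖ ^ 2 + ‖t i‖ ^ 2 - 2 * (star u * (star (t i) * Ψ i)).re := by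
      intro i
      rw [← Complex.normSq_eq_norm_sq, Complex.normSq_sub, Complex.normSq_mul,
        Complex.normSq_eq_norm_sq, Complex.normSq_eq_norm_sq, Complex.normSq_eq_norm_sq, hu]
      simp only [RCLike.star_def, map_mul]
      ring_nf
    simp only [h1]
    rw [Finset.sum_sub_distrib, Finset.sum_add_distrib, show ∑ i, ‖Ψ i‖ ^ 2 = 1 from hΨ,
      show ∑ i, ‖t i‖ ^ 2 = 1 from ht, ← Finset.mul_sum, ← Complex.re_sum, ← Finset.mul_sum]
    have : ∑ i, star (t i) * Ψ i = z := rfl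
    rw [this, huz, Complex.ofReal_re]
    ring
  refine ⟨u, hu, ?_⟩
  have h0 : 0 ≤ ∑ i, ‖Ψ i - u * t i‖ ^ 2 := Finset.sum_nonneg fun i _ => sq_nonneg _
  rw [hexp] at h0 ⊢
  -- Nonnegativity of `2 - 2‖z‖` gives `‖z‖ ≤ 1`, hence `‖z‖² ≤ ‖z‖`.
  nlinarith [norm_nonneg z]

variable {R A B : Type*} [Fintype R] [Fintype A] [Fintype B] [DecidableEq A] [DecidableEq B]

omit [DecidableEq A] [DecidableEq B] in
theorem posSemidef_reducedAB (ψ : R × A × B → ℂ) : (reducedAB ψ).PosSemidef := by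
  have e : reducedAB ψ = (Matrix.of fun (r : R) (x : A × B) => star (ψ (r, x)))ᴴ *
      Matrix.of fun (r : R) (x : A × B) => star (ψ (r, x)) := by
    ext x y
    simp [reducedAB, traceFst, proj, vecMulVec_apply, mul_apply]
  rw [e]
  exact posSemidef_conjTranspose_mul_self _

omit [DecidableEq A] [DecidableEq B] in
theorem posSemidef_reducedB (ψ : R × A × B → ℂ) : (reducedB ψ).PosSemidef := by
  have e : reducedB ψ = ∑ x : A, (reducedAB ψ).submatrix (fun y => (x, y)) (fun y => (x, y)) := by
    ext; simp [reducedB, traceFst, Matrix.sum_apply]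
  rw [e]
  exact posSemidef_sum _ fun x _ => (posSemidef_reducedAB ψ).submatrix _

theorem kyFan_vecMat_targetVec_le (ψ : R × A × B → ℂ) {L N M : ℕ} (hL : 1 ≤ L) (hLN : L ≤ N)
    (m : ℕ) : kyFan m (vecMat (targetVec ψ L N M) * (vecMat (targetVec ψ L N M))ᴴ) ≤
      kyFan 1 (reducedAB ψ) / L * m := by
  have hρ := posSemidef_reducedAB ψ
  have h0 : 0 ≤ kyFan 1 (reducedAB ψ) :=
    Finset.sum_nonneg fun k _ => (spec_antitone_nonneg hρ).2 k
  obtain ⟨P, hP, hP1, hPm, h⟩ := exists_trace_mul_eq_kyFan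
    (posSemidef_self_mul_conjTranspose (vecMat (targetVec ψ L N M))).1 m
  rw [← h]
  refine (trace_mul_le_of_le_smul hP (c := kyFan 1 (reducedAB ψ) / L) ?_).trans
    (mul_le_mul_of_nonneg_left hPm (div_nonneg h0 (Nat.cast_nonneg L)))
  rw [vecMat_targetVec ψ hLN]
  have := (posSemidef_smul_one_sub_kronecker_maxMixed (M := M) h0
    (posSemidef_kyFan_one_smul_sub hρ) hL).submatrix (Equiv.prodAssoc A B (Fin M)).symm
  rwa [submatrix_sub, submatrix_smul, Pi.sub_apply, Pi.sub_apply, Pi.smul_apply, Pi.smul_apply,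
    submatrix_one_equiv] at this

/-- Only the `K`-th majorization inequality is used: its left side is at least the largest
eigenvalue of `ψ^B`, and the `K` largest eigenvalues of the target's reduced state sum to at most
`K/L` times that of `ψ^{AB}`. -/
theorem Feasible.kyFan_one_reducedB_le {ψ : R × A × B → ℂ} (hψ : IsPureState ψ) {ε : ℝ}
    (hε : 0 < ε) {K L : ℕ} (h : Feasible ψ ε K L) :
    kyFan 1 (reducedB ψ) ≤ kyFan 1 (reducedAB ψ) / L * K + 3 * ε := by
  obtain ⟨hK, hL, N, M, hKNM, hLNM, J, p, Ψ, hp, hp1, hΨ, hmaj, hF⟩ := h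
  have ht := isPureState_targetVec hψ hL hLNM.1 hLNM.2
  set t := targetVec ψ L N M with htdef
  have h1 := kyFan_one_le_kyFan_kronecker_maxMixed (posSemidef_reducedB ψ) hK hKNM.2
  have hA : Nonempty (A × B) := by
    by_contra hne
    rw [not_nonempty_iff] at hne
    have : ∑ i, ‖ψ i‖ ^ 2 = 1 := hψ
    simp at this
  have hKD : K ≤ Fintype.card (A × B × Fin M) := by
    rw [← Fintype.card_congr (Equiv.prodAssoc A B (Fin M)), Fintype.card_prod, Fintype.card_fin]
    exact hKNM.2.trans (Nat.le_mul_of_pos_left _ Fintype.card_pos)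
  have h2 := hmaj.1 K hKD
  have hsum : ∑ l ∈ Finset.range K, ∑ j, p j * spec (traceFst (traceFst (proj (Ψ j)))) l =
      ∑ j, p j * kyFan K (vecMat (Ψ j) * (vecMat (Ψ j))ᴴ) := by
    rw [Finset.sum_comm]
    refine Finset.sum_congr rfl fun j _ => ?_
    rw [← Finset.mul_sum, traceFst_traceFst_proj]
    rfl
  rw [hsum] at h2
  rw [fidelitySqPure_sum_smul_proj] at hF
  set F := fun j => ‖star t ⬝ᵥ Ψ j‖ ^ 2 with hFdef
  have h3 : ∀ j, kyFan K (vecMat (Ψ j) * (vecMat (Ψ j))ᴴ) ≤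
      kyFan 1 (reducedAB ψ) / L * K + (2 * (1 - F j) / ε + ε) := by
    intro j
    obtain ⟨u, hu, hub⟩ := exists_phase ht (hΨ j)
    have hut : IsPureState fun i => u * t i := by
      simpa [IsPureState, norm_mul, hu] using ht
    have h4 := kyFan_vecMat_le (hΨ j) hut K
    have e : vecMat (fun i => u * t i) * (vecMat fun i => u * t i)ᴴ = vecMat t * (vecMat t)ᴴ := by
      have e1 : vecMat (fun i => u * t i) = u • vecMat t := rfl
      rw [e1, conjTranspose_smul, Matrix.smul_mul, Matrix.mul_smul, smul_smul, RCLike.star_def,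
        Complex.mul_conj', hu]
      simp
    rw [e] at h4
    have h5 := kyFan_vecMat_targetVec_le ψ (M := M) hL hLNM.1 K
    set s := Real.sqrt (∑ i, ‖Ψ j i - u * t i‖ ^ 2) with hs
    have hs2 : s ^ 2 ≤ 2 * (1 - F j) := by
      rw [hs, Real.sq_sqrt (Finset.sum_nonneg fun i _ => sq_nonneg _)]; exact hub
    -- Linearizing the square root makes the error affine in `F j`, so it averages directly. The
    -- mean infidelity is at most `ε²`, giving `2ε + ε = 3ε`.
    have h6 : 2 * s ≤ 2 * (1 - F j) / ε + ε := by
      have : s ^ 2 / ε ≤ 2 * (1 - F j) / ε := by gcongr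
      have h7 : 2 * s ≤ s ^ 2 / ε + ε := by
        rw [← sub_nonneg]
        have : s ^ 2 / ε + ε - 2 * s = (s - ε) ^ 2 / ε := by field_simp; ring
        rw [this]; positivity
      linarith
    linarith
  have h4 : ∑ j, p j * kyFan K (vecMat (Ψ j) * (vecMat (Ψ j))ᴴ) ≤
      ∑ j, p j * (kyFan 1 (reducedAB ψ) / L * K + (2 * (1 - F j) / ε + ε)) :=
    Finset.sum_le_sum fun j _ => mul_le_mul_of_nonneg_left (h3 j) (hp j)
  have h5 : ∑ j, p j * (kyFan 1 (reducedAB ψ) / L * K + (2 * (1 - F j) / ε + ε)) =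
      kyFan 1 (reducedAB ψ) / L * K + (2 * (1 - ∑ j, p j * F j) / ε + ε) := by
    have : ∀ j, p j * (kyFan 1 (reducedAB ψ) / L * K + (2 * (1 - F j) / ε + ε)) =
        p j * (kyFan 1 (reducedAB ψ) / L * K + 2 / ε + ε) - (2 / ε) * (p j * F j) := by
      intro j; ring
    simp only [this]
    rw [Finset.sum_sub_distrib, ← Finset.sum_mul, ← Finset.mul_sum, hp1]
    ring
  have h6 : 2 * (1 - ∑ j, p j * F j) / ε ≤ 2 * ε := by
    rw [div_le_iff₀ hε]
    nlinarith
  have h7 : kyFan K (reducedB ψ ⊗ₖ maxMixed K M) ≤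
    ∑ j, p j * kyFan K (vecMat (Ψ j) * (vecMat (Ψ j))ᴴ) := h2
  linarith

theorem le_converseBound {ψ : R × A × B → ℂ} (hψ : IsPureState ψ) {ε : ℝ}
    (hε : 0 < ε) (hε' : 3 * ε < kyFan 1 (reducedB ψ)) :
    ((Real.logb 2 (kyFan 1 (reducedB ψ) - 3 * ε) - Real.logb 2 (kyFan 1 (reducedAB ψ)) : ℝ) : EReal)
      ≤ converseBound ψ ε := by
  refine le_sInf ?_
  rintro _ ⟨K, L, h, rfl⟩
  have hle := h.kyFan_one_reducedB_le hψ hε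
  have hK : (0 : ℝ) < K := by exact_mod_cast h.1
  have hL : (0 : ℝ) < L := by exact_mod_cast h.2.1
  have hAB : 0 < kyFan 1 (reducedAB ψ) := by
    refine kyFan_one_pos (posSemidef_reducedAB ψ) ?_
    rw [trace_reducedAB, Complex.ofReal_re]; exact hψ
  rw [EReal.coe_le_coe_iff, ← Real.logb_div (by linarith) hAB.ne', ← Real.logb_div hK.ne' hL.ne']
  refine Real.logb_le_logb_of_le (by norm_num) (div_pos (by linarith) hAB) ?_
  rw [div_le_iff₀ hAB]
  have : kyFan 1 (reducedAB ψ) / L * K = K / L * kyFan 1 (reducedAB ψ) := by ring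
  linarith

theorem antitoneOn_converseBound (ψ : R × A × B → ℂ) :
    AntitoneOn (fun ε : ℝ => converseBound ψ ε) (Set.Ioi 0) := by
  intro ε hε ε' _ hle
  refine sInf_le_sInf ?_
  rintro c ⟨K, L, ⟨hK, hL, N, M, h1, h2, J, p, Ψ, hp, hp1, hΨ, hmaj, hF⟩, rfl⟩
  have hsq : ε ^ 2 ≤ ε' ^ 2 := pow_le_pow_left₀ (le_of_lt hε) hle 2
  exact ⟨K, L, ⟨hK, hL, N, M, h1, h2, J, p, Ψ, hp, hp1, hΨ, hmaj, by linarith⟩, rfl⟩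

end Converse

/-! ### Trace norm, fidelity and two-outcome tests -/

section TraceNorm

variable {n : Type*} [Fintype n] [DecidableEq n]

theorem cfc_sqrt_mul_self {ρ : Matrix n n ℂ} (hρ : ρ.PosSemidef) :
    (cfc Real.sqrt ρ)ᴴ = cfc Real.sqrt ρ ∧ cfc Real.sqrt ρ * cfc Real.sqrt ρ = ρ := by
  obtain ⟨U, hU, -, h, hs⟩ := spectral_mul_cfc_sqrt hρ.1
  refine ⟨cfc_predicate Real.sqrt ρ, ?_⟩
  rw [hs]
  calc _ = U * (diagonal (fun i => ((Real.sqrt (hρ.1.eigenvalues i) : ℝ) : ℂ)) * (Uᴴ * U) *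
        diagonal (fun i => ((Real.sqrt (hρ.1.eigenvalues i) : ℝ) : ℂ))) * Uᴴ := by
        simp only [Matrix.mul_assoc]
    _ = U * diagonal (fun i => (hρ.1.eigenvalues i : ℂ)) * Uᴴ := by
        rw [hU, Matrix.mul_one, diagonal_mul_diagonal]
        congr 3; ext i
        rw [← Complex.ofReal_mul, Real.mul_self_sqrt (hρ.eigenvalues_nonneg i)]
    _ = ρ := h.symm

/-- The trace norm as the overlap with a partial isometry, in a suitable orthonormal basis. -/
theorem exists_traceNorm_eq (X : Matrix n n ℂ) :
    0 ≤ traceNorm X ∧ ∃ U W : Matrix n n ℂ, U * Uᴴ = 1 ∧ (1 - W * Wᴴ).PosSemidef ∧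
      traceNorm X = (Wᴴ * X * U).trace.re := by
  have hX := posSemidef_conjTranspose_mul_self X
  obtain ⟨U, hU, hU', hXU, hs⟩ := spectral_mul_cfc_sqrt hX.1
  set d := hX.1.eigenvalues with hd
  have hd0 : ∀ i, 0 ≤ d i := hX.eigenvalues_nonneg
  have hD' : Uᴴ * (Xᴴ * X) * U = diagonal (fun i => (d i : ℂ)) := by
    rw [hXU]
    calc _ = (Uᴴ * U) * diagonal (fun i => (d i : ℂ)) * (Uᴴ * U) := by simp only [Matrix.mul_assoc]
      _ = _ := by rw [hU]; simp
  have hN : traceNorm X = ∑ i, Real.sqrt (d i) := by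
    rw [traceNorm, hs, Matrix.trace_mul_comm, ← Matrix.mul_assoc, hU, Matrix.one_mul,
      trace_diagonal, Complex.re_sum]
    simp only [Complex.ofReal_re]
  set T : Matrix n n ℂ := diagonal (fun i => (((Real.sqrt (d i))⁻¹ : ℝ) : ℂ)) with hT
  have hTH : Tᴴ = T := by
    rw [hT, diagonal_conjTranspose]; congr 1; ext i; simp
  set W := X * U * T with hW
  have hWX : Wᴴ * X * U = T * diagonal (fun i => (d i : ℂ)) := by
    rw [hW, conjTranspose_mul, conjTranspose_mul, hTH, ← hD']; simp only [Matrix.mul_assoc]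
  have hdd : ∀ i, (Real.sqrt (d i))⁻¹ * d i = Real.sqrt (d i) := fun i => by
    rw [inv_mul_eq_div, Real.div_sqrt]
  have hWE : W * (Wᴴ * W) = W := by
    have e : Wᴴ * W = T * diagonal (fun i => (d i : ℂ)) * T := by
      rw [← hWX]; simp only [hW, Matrix.mul_assoc]
    rw [e]
    conv_lhs => rw [hW, Matrix.mul_assoc]
    congr 1
    simp only [hT, diagonal_mul_diagonal]
    congr 1; ext i
    rw [← Complex.ofReal_mul, hdd, ← Complex.ofReal_mul, ← Complex.ofReal_mul]
    congr 1
    by_cases h0 : Real.sqrt (d i) = 0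
    · simp [h0]
    · field_simp
  refine ⟨by rw [hN]; exact Finset.sum_nonneg fun i _ => Real.sqrt_nonneg _, U, W, hU',
    (posSemidef_of_isHermitian_of_mul_self (P := W * Wᴴ) (by simp) (by
      rw [← Matrix.mul_assoc, Matrix.mul_assoc W, hWE])).2, ?_⟩
  rw [hWX, trace_mul_diagonal_re, hN]
  refine Finset.sum_congr rfl fun i _ => ?_
  rw [hT, diagonal_apply_eq, Complex.ofReal_re, hdd]

theorem trace_conjTranspose_mul_re_le {m k : Type*} [Fintype m] [Fintype k] (Y Z : Matrix m k ℂ) :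
    (Yᴴ * Z).trace.re ≤ Real.sqrt (Y * Yᴴ).trace.re * Real.sqrt (Z * Zᴴ).trace.re := by
  have e : ∀ X : Matrix m k ℂ, (X * Xᴴ).trace.re = ∑ p : k × m, ‖X p.2 p.1‖ ^ 2 := by
    intro X
    rw [Matrix.trace_mul_comm]
    simp only [Matrix.trace, diag_apply, mul_apply, conjTranspose_apply, Complex.re_sum,
      Fintype.sum_prod_type]
    refine Finset.sum_congr rfl fun i _ => Finset.sum_congr rfl fun j _ => ?_
    rw [RCLike.star_def, Complex.conj_mul']
    norm_cast
  rw [e, e]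
  refine le_trans ?_ (Real.sum_mul_le_sqrt_mul_sqrt Finset.univ _ _)
  simp only [Matrix.trace, diag_apply, mul_apply, conjTranspose_apply, Complex.re_sum,
    Fintype.sum_prod_type]
  refine Finset.sum_le_sum fun i _ => Finset.sum_le_sum fun j _ => ?_
  refine (Complex.re_le_norm _).trans (le_of_eq ?_)
  rw [norm_mul, norm_star]

/-- Cauchy–Schwarz for `S√ρ W` and `S√σ U`, where `P = S†S`; the factor `W` can only shrink the
norm, as `WW† ≤ 1`. -/
theorem trace_overlap_le {ρ σ P U W : Matrix n n ℂ} (hρ : ρ.PosSemidef) (hσ : σ.PosSemidef)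
    (hP : P.PosSemidef) (hU : U * Uᴴ = 1) (hW : (1 - W * Wᴴ).PosSemidef) :
    (Wᴴ * (cfc Real.sqrt ρ * P * cfc Real.sqrt σ) * U).trace.re ≤
      Real.sqrt (P * ρ).trace.re * Real.sqrt (P * σ).trace.re := by
  obtain ⟨S, hS⟩ := exists_eq_conjTranspose_mul_self hP
  obtain ⟨hA, hA2⟩ := cfc_sqrt_mul_self hρ
  obtain ⟨hB, hB2⟩ := cfc_sqrt_mul_self hσ
  set A := cfc Real.sqrt ρ
  set B := cfc Real.sqrt σ
  have e : Wᴴ * (A * P * B) * U = (S * A * W)ᴴ * (S * B * U) := by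
    rw [conjTranspose_mul, conjTranspose_mul, hA, hS]; simp only [Matrix.mul_assoc]
  rw [e]
  refine (trace_conjTranspose_mul_re_le _ _).trans ?_
  have e1 : ∀ τ : Matrix n n ℂ, (S * τ * Sᴴ).trace = (P * τ).trace := by
    intro τ
    rw [Matrix.mul_assoc, Matrix.trace_mul_comm, hS, Matrix.mul_assoc, Matrix.trace_mul_comm]
  have h2 : S * B * U * (S * B * U)ᴴ = S * σ * Sᴴ := by
    rw [conjTranspose_mul, conjTranspose_mul, hB]
    calc _ = S * (B * (U * Uᴴ) * B) * Sᴴ := by simp only [Matrix.mul_assoc]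
      _ = _ := by rw [hU, Matrix.mul_one, hB2]
  have h1 : (S * A * W * (S * A * W)ᴴ).trace.re ≤ (P * ρ).trace.re := by
    have h := (Complex.le_def.mp (hW.mul_mul_conjTranspose_same (S * A)).trace_nonneg).1
    have e2 : S * A * (1 - W * Wᴴ) * (S * A)ᴴ = S * ρ * Sᴴ - S * A * W * (S * A * W)ᴴ := by
      have : S * ρ * Sᴴ = S * A * (S * A)ᴴ := by
        rw [conjTranspose_mul, hA, ← hA2]; simp only [Matrix.mul_assoc]
      rw [this, conjTranspose_mul (S * A) W, Matrix.mul_sub, Matrix.sub_mul, Matrix.mul_one]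
      simp only [Matrix.mul_assoc]
    rw [e2, trace_sub, e1, Complex.sub_re] at h
    simpa using h
  rw [h2, e1]
  gcongr

/-- Fidelity does not decrease under the test `{P, 1 - P}`: insert `P + (1 - P)` between the two
square roots and bound each term. -/
theorem traceNorm_cfc_sqrt_mul_le {ρ σ P : Matrix n n ℂ} (hρ : ρ.PosSemidef) (hσ : σ.PosSemidef)
    (hP : P.PosSemidef) (hP1 : (1 - P).PosSemidef) :
    traceNorm (cfc Real.sqrt ρ * cfc Real.sqrt σ) ≤
      Real.sqrt (P * ρ).trace.re * Real.sqrt (P * σ).trace.re +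
      Real.sqrt (ρ.trace.re - (P * ρ).trace.re) * Real.sqrt (σ.trace.re - (P * σ).trace.re) := by
  obtain ⟨-, U, W, hU, hW, h⟩ := exists_traceNorm_eq (cfc Real.sqrt ρ * cfc Real.sqrt σ)
  have h1 := trace_overlap_le hρ hσ hP hU hW
  have h2 := trace_overlap_le hρ hσ hP1 hU hW
  simp only [Matrix.sub_mul, Matrix.one_mul, trace_sub, Complex.sub_re] at h2
  rw [h]
  refine le_trans (le_of_eq ?_) (add_le_add h1 h2)
  rw [← Complex.add_re, ← trace_add]
  congr 2
  rw [← Matrix.add_mul, ← Matrix.mul_add, ← Matrix.add_mul]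
  simp [Matrix.mul_sub]

/-- The Fuchs–van de Graaf inequality for two outcomes: expand the square and apply AM–GM to the
cross term. -/
theorem sub_sq_le_of_binary_fidelity {p q F : ℝ} (hp0 : 0 ≤ p) (hp1 : p ≤ 1) (hq0 : 0 ≤ q)
    (hq1 : q ≤ 1) (hF0 : 0 ≤ F)
    (hF : F ≤ Real.sqrt p * Real.sqrt q + Real.sqrt (1 - p) * Real.sqrt (1 - q)) :
    (p - q) ^ 2 ≤ 1 - F ^ 2 := by
  have a := Real.sq_sqrt hp0
  have b := Real.sq_sqrt hq0
  have c := Real.sq_sqrt (sub_nonneg.mpr hp1)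
  have d := Real.sq_sqrt (sub_nonneg.mpr hq1)
  have h := pow_le_pow_left₀ hF0 hF 2
  set x := Real.sqrt p
  set y := Real.sqrt q
  set z := Real.sqrt (1 - p)
  set w := Real.sqrt (1 - q)
  have h2 : (x * y + z * w) ^ 2 = p * q + (1 - p) * (1 - q) + 2 * (x * z) * (y * w) := by
    rw [← a, ← b]
    have : 1 - x ^ 2 = z ^ 2 := by rw [a, c]
    have h3 : 1 - y ^ 2 = w ^ 2 := by rw [b, d]
    rw [this, h3]; ring
  have h3 : 2 * (x * z) * (y * w) ≤ p * (1 - p) + q * (1 - q) := by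
    have : p * (1 - p) = (x * z) ^ 2 := by rw [mul_pow, a, c]
    have h4 : q * (1 - q) = (y * w) ^ 2 := by rw [mul_pow, b, d]
    rw [this, h4]
    nlinarith [sq_nonneg (x * z - y * w)]
  nlinarith

theorem traceNorm_of_posSemidef {ρ : Matrix n n ℂ} (hρ : ρ.PosSemidef) :
    traceNorm ρ = ρ.trace.re := by
  have hsa : IsSelfAdjoint ρ := hρ.1
  have h0 : ∀ x ∈ spectrum ℝ ρ, 0 ≤ x := by
    intro x hx
    rw [hρ.1.spectrum_real_eq_range_eigenvalues] at hx
    obtain ⟨i, rfl⟩ := hx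
    exact hρ.eigenvalues_nonneg i
  have e : ρᴴ * ρ = cfc (fun x : ℝ => x * x) ρ := by
    rw [cfc_mul (fun x : ℝ => x) (fun x : ℝ => x) ρ, cfc_id' ℝ ρ, hρ.1]
  rw [traceNorm, e, ← cfc_comp' Real.sqrt (fun x : ℝ => x * x) ρ,
    cfc_congr (g := fun x : ℝ => x) (fun x hx => Real.sqrt_mul_self (h0 x hx)), cfc_id' ℝ ρ]

theorem genFidelity_self {ρ : Matrix n n ℂ} (hρ : ρ.PosSemidef) (h1 : ρ.trace.re = 1) :
    genFidelity ρ ρ = 1 := by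
  rw [genFidelity, (cfc_sqrt_mul_self hρ).2, traceNorm_of_posSemidef hρ, h1]
  simp

end TraceNorm

/-! ### Smooth min-entropy for vanishing smoothing -/

section SmoothMinEntropy

variable {n : Type*} [Fintype n] [DecidableEq n]

theorem le_smoothMinEntropy {ρ : Matrix n n ℂ} (hρ : ρ.PosSemidef) (h1 : ρ.trace.re = 1) {ε : ℝ}
    (hε : 0 ≤ ε) : ((-Real.logb 2 (kyFan 1 ρ) : ℝ) : EReal) ≤ smoothMinEntropy ε ρ := by
  have h : ((-Real.logb 2 (kyFan 1 ρ) : ℝ) : EReal) ≤ minEntropy ρ := by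
    refine le_sSup ⟨_, rfl, ?_⟩
    rw [neg_neg, Real.rpow_logb (by norm_num) (by norm_num) (kyFan_one_pos hρ h1)]
    exact posSemidef_kyFan_one_smul_sub hρ
  refine h.trans (le_sSup ⟨ρ, hρ, h1.le, ?_, rfl⟩)
  rw [purifiedDist, genFidelity_self hρ h1]
  simpa using hε

/-- Test with `P` optimal for `ρ`: its value on a nearby `σ` is at least `kyFan 1 ρ - ε`, and at
most `2^{-h}` whenever `σ ≤ 2^{-h}`. -/
theorem smoothMinEntropy_le {ρ : Matrix n n ℂ} (hρ : ρ.PosSemidef) (h1 : ρ.trace.re = 1) {ε : ℝ}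
    (hε : ε < kyFan 1 ρ) :
    smoothMinEntropy ε ρ ≤ ((-Real.logb 2 (kyFan 1 ρ - ε) : ℝ) : EReal) := by
  refine sSup_le ?_
  rintro _ ⟨σ, hσ, hσ1, hd, rfl⟩
  obtain ⟨P, hP, hP1, hPm, hPρ⟩ := exists_trace_mul_eq_kyFan hρ.1 1
  have hF := traceNorm_cfc_sqrt_mul_le hρ hσ hP hP1
  have hq0 := trace_mul_re_nonneg hP hσ
  have hq1 := trace_mul_re_nonneg hP1 hσ
  have hp0 := trace_mul_re_nonneg hP hρ
  have hp1 := trace_mul_re_nonneg hP1 hρ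
  rw [Matrix.sub_mul, Matrix.one_mul, trace_sub, Complex.sub_re] at hq1 hp1
  rw [h1] at hF hp1
  set q := (P * σ).trace.re with hq
  rw [hPρ] at hF hp0 hp1
  set p := kyFan 1 ρ
  have hF0 := (exists_traceNorm_eq (cfc Real.sqrt ρ * cfc Real.sqrt σ)).1
  have hgen : genFidelity ρ σ = traceNorm (cfc Real.sqrt ρ * cfc Real.sqrt σ) := by
    rw [genFidelity, h1]; simp
  rw [purifiedDist, hgen] at hd
  set F := traceNorm (cfc Real.sqrt ρ * cfc Real.sqrt σ)
  -- Since `tr σ ≤ 1`, the second weight `tr σ - q` may be enlarged to `1 - q`.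
  have hF' : F ≤ Real.sqrt p * Real.sqrt q + Real.sqrt (1 - p) * Real.sqrt (1 - q) := by
    refine hF.trans ?_
    gcongr
  have hsq := sub_sq_le_of_binary_fidelity hp0 (by linarith) hq0 (by linarith) hF0 hF'
  have hpq : p - q ≤ ε := by
    refine le_trans ?_ hd
    refine (le_abs_self _).trans ?_
    rw [← Real.sqrt_sq_eq_abs]
    exact Real.sqrt_le_sqrt hsq
  refine sSup_le ?_
  rintro _ ⟨h, rfl, hh⟩
  have h2 := trace_mul_le_of_le_smul hP hh
  have h3 : (2 : ℝ) ^ (-h) * P.trace.re ≤ (2 : ℝ) ^ (-h) :=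
    mul_le_of_le_one_right (by positivity) (by exact_mod_cast hPm)
  have h4 : p - ε ≤ (2 : ℝ) ^ (-h) := by linarith
  rw [EReal.coe_le_coe_iff]
  have h5 := Real.logb_le_logb_of_le (b := 2) (by norm_num) (by linarith) h4
  rw [Real.logb_rpow (by norm_num) (by norm_num)] at h5
  linarith

theorem tendsto_logb_sub {p : ℝ} (hp : 0 < p) (c : ℝ) :
    Tendsto (fun ε : ℝ => Real.logb 2 (p - c * ε)) (𝓝[>] 0) (𝓝 (Real.logb 2 p)) := by
  have h1 : Tendsto (fun ε : ℝ => p - c * ε) (𝓝[>] 0) (𝓝 p) := by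
    have : Continuous fun ε : ℝ => p - c * ε := by fun_prop
    simpa using (this.tendsto 0).mono_left (nhdsWithin_le_nhds (s := Set.Ioi 0))
  exact (Real.continuousAt_logb hp.ne').tendsto.comp h1

theorem tendsto_smoothMinEntropy {ρ : Matrix n n ℂ} (hρ : ρ.PosSemidef) (h1 : ρ.trace.re = 1) :
    Tendsto (fun ε : ℝ => smoothMinEntropy ε ρ) (𝓝[>] 0)
      (𝓝 ((-Real.logb 2 (kyFan 1 ρ) : ℝ) : EReal)) := by
  have hp := kyFan_one_pos hρ h1
  have hu : Tendsto (fun ε : ℝ => ((-Real.logb 2 (kyFan 1 ρ - 1 * ε) : ℝ) : EReal)) (𝓝[>] 0)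
      (𝓝 ((-Real.logb 2 (kyFan 1 ρ) : ℝ) : EReal)) :=
    EReal.tendsto_coe.mpr (tendsto_logb_sub hp 1).neg
  refine tendsto_of_tendsto_of_tendsto_of_le_of_le' tendsto_const_nhds hu ?_ ?_
  · filter_upwards [self_mem_nhdsWithin] with ε hε using le_smoothMinEntropy hρ h1 (le_of_lt hε)
  · filter_upwards [Ioo_mem_nhdsGT hp] with ε hε
    rw [one_mul]
    exact smoothMinEntropy_le hρ h1 hε.2

end SmoothMinEntropy

end

end StateMerging

theorem mainTheorem5 {R A B : Type*} [Fintype R] [Fintype A] [Fintype B]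
    [DecidableEq A] [DecidableEq B]
    (ψ : R × A × B → ℂ) (hψ : StateMerging.IsPureState ψ) :
    (∀ (ε : ℝ), 0 ≤ ε → ∀ (K L N M : ℕ)
      (E : Matrix ((A × Fin N) × (B × Fin M)) ((A × Fin N) × (B × Fin M)) ℂ →ₗ[ℂ]
        Matrix (Fin N × (A × B × Fin M)) (Fin N × (A × B × Fin M)) ℂ),
      StateMerging.IsApproxMerging ψ ε K L N M E →
        StateMerging.converseBound ψ ε ≤ ((Real.logb 2 K - Real.logb 2 L : ℝ) : EReal)) ∧
    (∃ (l : EReal) (h : ℝ),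
      Tendsto (fun ε : ℝ => StateMerging.converseBound ψ ε) (𝓝[>] 0) (𝓝 l) ∧
      Tendsto (fun e : ℝ × ℝ =>
          StateMerging.smoothMinEntropy e.2 (StateMerging.reducedAB ψ) -
            StateMerging.smoothMinEntropy (e.1 + e.2) (StateMerging.reducedB ψ))
        (𝓝[>] 0 ×ˢ 𝓝[>] 0) (𝓝 (h : EReal)) ∧
      (h : EReal) ≤ l) := by
  refine ⟨fun ε _ K L N M E hE => sInf_le ⟨K, L, hE.feasible hψ, rfl⟩, ?_⟩
  have hAB1 : (StateMerging.reducedAB ψ).trace.re = 1 := by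
    rw [StateMerging.trace_reducedAB, Complex.ofReal_re]; exact hψ
  have hB1 : (StateMerging.reducedB ψ).trace.re = 1 := by
    rw [StateMerging.trace_reducedB, Complex.ofReal_re]; exact hψ
  have hAB := StateMerging.posSemidef_reducedAB ψ
  have hB := StateMerging.posSemidef_reducedB ψ
  have hpB := StateMerging.kyFan_one_pos hB hB1
  -- By monotonicity the limit at `0⁺` exists and is the supremum over positive `ε`.
  have hlim := (StateMerging.antitoneOn_converseBound ψ).tendsto_nhdsGT (OrderTop.bddAbove _)
  refine ⟨_, Real.logb 2 (StateMerging.kyFan 1 (StateMerging.reducedB ψ)) -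
    Real.logb 2 (StateMerging.kyFan 1 (StateMerging.reducedAB ψ)), hlim, ?_, ?_⟩
  · have h1 := (StateMerging.tendsto_smoothMinEntropy hAB hAB1).comp
      (tendsto_snd (f := 𝓝[>] (0 : ℝ)) (g := 𝓝[>] (0 : ℝ)))
    have hadd : Tendsto (fun e : ℝ × ℝ => e.1 + e.2) (𝓝[>] 0 ×ˢ 𝓝[>] 0) (𝓝[>] 0) := by
      refine tendsto_nhdsWithin_iff.mpr ⟨?_, ?_⟩
      · have := (tendsto_fst (f := 𝓝[>] (0 : ℝ)) (g := 𝓝[>] (0 : ℝ))).mono_right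
          nhdsWithin_le_nhds |>.add
          ((tendsto_snd (f := 𝓝[>] (0 : ℝ)) (g := 𝓝[>] (0 : ℝ))).mono_right nhdsWithin_le_nhds)
        simpa using this
      · filter_upwards [prod_mem_prod self_mem_nhdsWithin self_mem_nhdsWithin] with e he
        exact add_pos (Set.mem_Ioi.mp he.1) (Set.mem_Ioi.mp he.2)
    have h2 := (StateMerging.tendsto_smoothMinEntropy hB hB1).comp hadd
    -- Addition of extended reals is continuous here because both limits are finite.
    have h3 := (EReal.continuousAt_add_coe_coe _ _).tendsto.comp
      (h1.prodMk_nhds ((continuous_neg.tendsto _).comp h2))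
    refine (h3.congr fun e => (sub_eq_add_neg _ _).symm).trans (le_of_eq ?_)
    rw [← EReal.coe_add]
    congr 2
    ring
  · have h1 := EReal.tendsto_coe.mpr ((StateMerging.tendsto_logb_sub hpB 3).sub_const
      (Real.logb 2 (StateMerging.kyFan 1 (StateMerging.reducedAB ψ))))
    refine le_of_tendsto_of_tendsto h1 hlim ?_
    filter_upwards [Ioo_mem_nhdsGT (div_pos hpB three_pos)] with ε hε
    refine StateMerging.le_converseBound hψ hε.1 ?_
    have := (lt_div_iff₀ three_pos).mp hε.2
    linarith
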